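/- Let $q\ge 0$ be an integer, put $p=q+1$ and $n=p+1$, and let $A$ be an associative unital real algebra of dimension $p+1$ (not necessarily commutative), with unit $e_0$, equipped with any norm making it a normed algebra. Let $\alpha_m,\beta_m,\gamma_m\in A$ for $m=2,\dots,p$, and let $\widetilde A=(a^j_m)_{0\le j\le p,\;2\le m\le p}$ be the $(p+1)\times(p-1)$ matrix over $A$ with first row $(\alpha_2,\dots,\alpha_p)$, second row $(\beta_2,\dots,\beta_p)$, and whose last $p-1$ rows form the diagonal matrix with diagonal entries $\gamma_2,\dots,\gamma_p$. Coordinates of $\mathbb R^n$ are indexed by $0,\dots,p$, $\|\cdot\|$ is the Euclidean norm, and $dV=dx_0\wedge\dots\wedge dx_p$. For a bounded domain $D\subset\mathbb R^n$ with smooth boundary, let $\mathcal C(D)$ be the set of functions $f:\overline D\to A$ of class $C^1$ satisfying on $D$ the $q$ Cauchy conditions $$\sum_{j=0}^{p}\frac{\partial f}{\partial x_j}\,a^j_m=0,\qquad m=2,\dots,p.$$ Then the following two statements are equivalent. (1) (Cauchy formula with linear $\varphi_m$.) There are elements $b^i_m\in A$ ($0\le i\le p$, $2\le m\le p$) such that,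 with $\varphi_m(x,y)=\sum_{i=0}^{p}b^i_m(y_i-x_i)$, for every bounded domain $D\subset\mathbb R^n$ with smooth boundary, every $f\in\mathcal C(D)$ and every $x\in D$, $$f(x)=\int_{\partial D}f(y)\sum_{m=2}^{p}\Big(\sum_{j=0}^{p}a^j_m\frac{\partial}{\partial y_j}\Big)\lrcorner\Big(\frac{\varphi_m(x,y)}{\|y-x\|^{n}}\,dV\Big) =\int_{\partial D}f(y)\sum_{m=2}^{p}\sum_{j=0}^{p}a^j_m\,\varphi_m(x,y)\,\frac{\nu_j(y)}{\|y-x\|^{n}}\,d\sigma(y),$$ where $\nu$ is the outward unit normal and $\sigma$ the surface measure of $\partial D$, the integrand being integrable. (2) All the $\gamma_m$ are invertible in $A$, and $$\Big(e_0+\sum_{m=2}^{p}(\alpha_m\gamma_m^{-1})^2,\;\; e_0+\sum_{m=2}^{p}(\beta_m\gamma_m^{-1})^2,\;\; \sum_{m=2}^{p}\big(\alpha_m\gamma_m^{-1}\beta_m\gamma_m^{-1}+\beta_m\gamma_m^{-1}\alpha_m\gamma_m^{-1}\big)\Big)$$ belongs to the right $A$-submodule of $A^3$ generated by the triples $$\begin{aligned}\Big(&(\alpha_{m'}\gamma_{m'}^{-1})(\alpha_m\gamma_m^{-1})\gamma_{m'}-(\alpha_m\gamma_m^{-1})\alpha_{m'},\;\;(\beta_{m'}\gamma_{m'}^{-1})(\beta_m\gamma_m^{-1})\gamma_{m'}-(\beta_m\gamma_m^{-1})\beta_{m'},\\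 &(\beta_{m'}\gamma_{m'}^{-1})(\alpha_m\gamma_m^{-1})\gamma_{m'}+(\alpha_{m'}\gamma_{m'}^{-1})(\beta_m\gamma_m^{-1})\gamma_{m'}-(\beta_m\gamma_m^{-1})\alpha_{m'}-(\alpha_m\gamma_m^{-1})\beta_{m'}\Big),\qquad 2\le m<m'\le p.\end{aligned}$$ In particular, when the diagonal block is invertible, the Cauchy formula holds if and only if this membership holds. -/

import Mathlib

open MeasureTheory Topology
open scoped ContDiff

noncomputable section

namespace CauchyAlgebra

section Domains

variable {n : ℕ}

/-- `ρ` is a smooth local defining function of `D` at `p`: `dρ(p) ≠ 0` and, near `p`, the set `D`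
is `{ρ < 0}`. -/
structure IsDefiningFunctionAt (D : Set (EuclideanSpace ℝ (Fin n))) (p : EuclideanSpace ℝ (Fin n))
    (ρ : EuclideanSpace ℝ (Fin n) → ℝ) : Prop where
  contDiff : ContDiff ℝ ∞ ρ
  gradient_ne_zero : gradient ρ p ≠ 0
  mem_iff : ∀ᶠ y in 𝓝 p, (y ∈ D ↔ ρ y < 0)

/-- A bounded domain (nonempty connected open set) of `ℝⁿ` with smooth boundary. -/
structure IsSmoothBoundedDomain (D : Set (EuclideanSpace ℝ (Fin n))) : Prop where
  isOpen : IsOpen D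
  isConnected : IsConnected D
  isBounded : Bornology.IsBounded D
  smooth_boundary : ∀ p ∈ frontier D, ∃ ρ, IsDefiningFunctionAt D p ρ

open Classical in
/-- The outward unit normal `∇ρ(p) / ‖∇ρ(p)‖` of `D` at a boundary point `p`, for a local defining
function `ρ` of `D` at `p` (the vector does not depend on the choice of `ρ`). -/
def outwardNormal (D : Set (EuclideanSpace ℝ (Fin n))) (p : EuclideanSpace ℝ (Fin n)) :
    EuclideanSpace ℝ (Fin n) :=
  if h : ∃ ρ, IsDefiningFunctionAt D p ρ then
    ‖gradient h.choose p‖⁻¹ • gradient h.choose p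
  else 0

end Domains

section CauchyFormula

variable {A : Type*} [NormedRing A] [NormedAlgebra ℝ A] {n q : ℕ}

/-- `f` is of class `C¹` on the closure of `D` and satisfies on `D` the `q` Cauchy conditions
`∑ⱼ ∂f/∂xⱼ · a j m = 0`, `m = 1, …, q`. -/
structure IsCauchyFunction (a : Matrix (Fin n) (Fin q) A) (D : Set (EuclideanSpace ℝ (Fin n)))
    (f : EuclideanSpace ℝ (Fin n) → A) : Prop where
  contDiffOn : ContDiffOn ℝ 1 f (closure D)
  cauchy : ∀ x ∈ D, ∀ m : Fin q,
    ∑ j : Fin n, fderiv ℝ f x (EuclideanSpace.single j 1) * a j m = 0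

/-- The linear function `φₘ(x, y) = ∑ᵢ b i m (yᵢ - xᵢ)`. -/
def linearPhi (b : Matrix (Fin n) (Fin q) A) (m : Fin q) (x y : EuclideanSpace ℝ (Fin n)) : A :=
  ∑ i : Fin n, (y i - x i) • b i m

/-- The density, with respect to the surface measure of `∂D`, of the restriction to `∂D` of the
`(n-1)`-form `∑ₘ (∑ⱼ a j m ∂/∂yⱼ) ⌟ (φₘ(x, y) / ‖y - x‖ⁿ dV)`; here `∂/∂yⱼ ⌟ dV` restricts to
`νⱼ dσ`, where `ν` is the outward unit normal. -/
def kernelDensity (a b : Matrix (Fin n) (Fin q) A) (D : Set (EuclideanSpace ℝ (Fin n)))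
    (x y : EuclideanSpace ℝ (Fin n)) : A :=
  ∑ m : Fin q, ∑ j : Fin n,
    (outwardNormal D y j / ‖y - x‖ ^ n) • (a j m * linearPhi b m x y)

/-- The functions satisfying the Cauchy conditions with coefficients `a` admit a Cauchy formula
with linear `φₘ`: there are coefficients `b i m ∈ A` such that, on every bounded domain with smooth
boundary, every function satisfying the Cauchy conditions is reproduced from its boundary values
by the corresponding kernel. The surface measure is the `(n-1)`-dimensional Hausdorff measure, in
its Euclidean normalization. -/
def AdmitsLinearCauchyFormula (a : Matrix (Fin n) (Fin q) A) : Prop :=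
  ∃ b : Matrix (Fin n) (Fin q) A,
    ∀ D : Set (EuclideanSpace ℝ (Fin n)), IsSmoothBoundedDomain D →
      ∀ f : EuclideanSpace ℝ (Fin n) → A, IsCauchyFunction a D f →
        ∀ x ∈ D,
          IntegrableOn (fun y => f y * kernelDensity a b D x y) (frontier D)
            (Measure.euclideanHausdorffMeasure (n - 1)) ∧
          f x = ∫ y in frontier D, f y * kernelDensity a b D x y
            ∂(Measure.euclideanHausdorffMeasure (n - 1))

end CauchyFormula

section SpecialCase

variable {A : Type*} [Ring A] {q : ℕ}

/-- The coefficient matrix with `q + 2` rows and `q` columns whose first two rows are `α` and `β`,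
and whose last `q` rows form the diagonal matrix with entries `γ`. -/
def coeffMatrix (α β γ : Fin q → A) : Matrix (Fin (q + 2)) (Fin q) A :=
  Matrix.of (Matrix.vecCons α (Matrix.vecCons β fun k => Matrix.diagonal γ k))

/-- The triple of `A³` on the left-hand side of the algebraic condition; `c` stands for the inverses
of the diagonal entries. -/
def conditionTriple (α β c : Fin q → A) : A × A × A :=
  (1 + ∑ m, (α m * c m) ^ 2,
    1 + ∑ m, (β m * c m) ^ 2,
    ∑ m, (α m * c m * (β m * c m) + β m * c m * (α m * c m)))

/-- The triple of `A³` attached to a pair of indices `m < m'`; `c` stands for the inverses of the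
diagonal entries `γ`. -/
def commutatorTriple (α β γ c : Fin q → A) (m m' : Fin q) : A × A × A :=
  ((α m' * c m') * (α m * c m) * γ m' - (α m * c m) * α m',
    (β m' * c m') * (β m * c m) * γ m' - (β m * c m) * β m',
    (β m' * c m') * (α m * c m) * γ m' + (α m' * c m') * (β m * c m) * γ m'
      - (β m * c m) * α m' - (α m * c m) * β m')

/-- The algebraic condition: all `γ m` are invertible, and the triple `conditionTriple` belongs to
the right submodule of `A³` (that is, the submodule over the opposite ring) generated by the
`commutatorTriple`s, `m < m'`. -/
def AlgebraicCondition (α β γ : Fin q → A) : Prop :=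
  (∀ m, IsUnit (γ m)) ∧
    conditionTriple α β (fun m => Ring.inverse (γ m)) ∈
      Submodule.span Aᵐᵒᵖ
        {t : A × A × A | ∃ m m' : Fin q, m < m' ∧
          t = commutatorTriple α β γ (fun k => Ring.inverse (γ k)) m m'}

end SpecialCase

end CauchyAlgebra

end

/-! Write `N_j(u) = ∑_m a^j_m φ_m(u)`, `K_j(u) = N_j(u)/‖u‖^n` and `Q(u) = ∑_j u_j N_j(u)`. If `f`
satisfies the Cauchy conditions, `∑_j ∂_j f · K_j` vanishes by associativity, so the divergence of
`f K` is `f · div K`, and off the singularity `div K = ‖u‖^{-n} (tr Q - n Q(u)/‖u‖²)`.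

The formula holds for some `b` exactly when some `b` makes `Q(u) = ‖u‖² · 1`
(`admitsLinearCauchyFormula_iff`). If `Q = ‖u‖² c`, then `div K` vanishes off the singularity, and
the divergence theorem leaves a positive multiple of `f(x) c`; the multiple, `radialMass`, is never
evaluated, since rescaling `b` absorbs it. Conversely, take `f = 1`: the flux of `K` is the same
through a domain around the singularity and through that domain with a small ball removed elsewhere,
so `div K = 0` off the singularity and `Q` is radial (`kernelForm_eq_of_flux`). The singularity is
never excised: `K` is replaced by a `C¹` field equal to it outside a small ball (`cutoffKernel`),
whose divergence in the radial case is `c` times an approximate identity.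

The divergence theorem is needed for functions `C¹` up to the boundary and for Hausdorff measure
(`IsSmoothBoundedDomain.integral_fderiv_eq`). In a small ball the boundary is a nearly flat graph:
Fubini along a transversal direction and the fundamental theorem of calculus turn the volume
integral into one over the tangent hyperplane, and projecting the boundary there distorts its
measure by a factor close to `1`. A partition of unity adds the local errors up to at most `ε ∫
‖φ‖`, for every `ε > 0`.

What remains is algebra (`exists_kernelForm_iff_algebraicCondition`). Comparing coefficients in `Q =
‖u‖²` gives `γ_k b^k_k = 1`, hence invertibility by finite dimension. The matrix `S k l = γ_k b^l_k`
has unit diagonal and is antisymmetric off it; the first two rows of `b` are eliminated through the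
mixed equations, and the three remaining equations say that the condition triple is a right
combination of the commutator triples. -/

namespace CauchyAlgebra

open Module Set Filter
open scoped RealInnerProductSpace ENNReal NNReal Manifold

/-! ### Volume in slanted coordinates along a transversal direction -/

section SlantedCoordinates

variable {E : Type*} [NormedAddCommGroup E] [InnerProductSpace ℝ E]

/-- The projection along `τ` onto the hyperplane orthogonal to `ν` (where `⟪ν, τ⟫ = 1`). -/
noncomputable def slantProj (ν τ : E) : E →L[ℝ] (ℝ ∙ ν)ᗮ :=
  (ℝ ∙ ν)ᗮ.orthogonalProjectionOnto ∘L
    (ContinuousLinearMap.id ℝ E - (innerSL ℝ ν).smulRight τ)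

theorem slantProj_coe {ν τ : E} (h : ⟪ν, τ⟫ = 1) (u : E) :
    (slantProj ν τ u : E) = u - ⟪ν, u⟫ • τ := by
  have hmem : u - ⟪ν, u⟫ • τ ∈ (ℝ ∙ ν)ᗮ := by
    rw [Submodule.mem_orthogonal_singleton_iff_inner_right, inner_sub_right, inner_smul_right, h]
    ring
  simpa [slantProj] using
    congrArg Subtype.val (Submodule.orthogonalProjectionOnto_mem_subspace_eq_self
      (⟨u - ⟪ν, u⟫ • τ, hmem⟩ : (ℝ ∙ ν)ᗮ))

theorem slantProj_add_smul {ν τ : E} (h : ⟪ν, τ⟫ = 1) (w : (ℝ ∙ ν)ᗮ) (t : ℝ) :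
    slantProj ν τ (w + t • τ) = w := by
  have hw : ⟪ν, (w : E)⟫ = 0 := Submodule.mem_orthogonal_singleton_iff_inner_right.1 w.2
  apply Subtype.ext
  rw [slantProj_coe h, inner_add_right, inner_smul_right, h, hw]
  simp

theorem slantProj_add {ν τ : E} (h : ⟪ν, τ⟫ = 1) (u : E) :
    (slantProj ν τ u : E) + ⟪ν, u⟫ • τ = u := by
  rw [slantProj_coe h]; abel

variable [FiniteDimensional ℝ E] [MeasurableSpace E] [BorelSpace E]

/-- The orthogonal splitting along `ν` is an isometry, and replacing `ν` by `τ` is a shear by the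
vector `τ - ν` of the hyperplane; a shear translates each slice and so preserves volume. -/
theorem measurePreserving_slanted {ν τ : E} (hν : ‖ν‖ = 1) (h : ⟪ν, τ⟫ = 1) :
    MeasurePreserving (fun x : (ℝ ∙ ν)ᗮ × ℝ => (x.1 : E) + x.2 • τ) volume volume := by
  have hν0 : ν ≠ 0 := by rintro rfl; simp at hν
  let L : WithLp 2 ((ℝ ∙ ν)ᗮ × ℝ) →ₗᵢ[ℝ] E :=
    { toFun := fun x => (x.fst : E) + x.snd • ν
      map_add' := fun x y => by simp [add_smul]; abel
      map_smul' := fun c x => by simp [smul_smul]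
      norm_map' := fun x => by
        have hw : ⟪(x.fst : E), ν⟫ = 0 :=
          Submodule.mem_orthogonal_singleton_iff_inner_left.1 x.fst.2
        have h1 : ‖(x.fst : E) + x.snd • ν‖ ^ 2 = ‖x‖ ^ 2 := by
          rw [WithLp.prod_norm_sq_eq_of_L2, norm_add_sq_real, inner_smul_right, hw, norm_smul, hν]
          simp
        exact (pow_left_inj₀ (norm_nonneg _) (norm_nonneg _) two_ne_zero).1 h1 }
  have hfin : finrank ℝ (WithLp 2 ((ℝ ∙ ν)ᗮ × ℝ)) = finrank ℝ E := by
    have h1 := Submodule.finrank_add_finrank_orthogonal (ℝ ∙ ν)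
    rw [finrank_span_singleton hν0] at h1
    rw [(WithLp.linearEquiv 2 ℝ ((ℝ ∙ ν)ᗮ × ℝ)).finrank_eq, finrank_prod, finrank_self]
    omega
  have hL : MeasurePreserving (L.toLinearIsometryEquiv hfin) volume volume :=
    LinearIsometryEquiv.measurePreserving _
  have h1 := hL.comp (WithLp.volume_preserving_toLp ((ℝ ∙ ν)ᗮ) ℝ)
  let v : (ℝ ∙ ν)ᗮ := ⟨τ - ν, by
    rw [Submodule.mem_orthogonal_singleton_iff_inner_right, inner_sub_right, h,
      real_inner_self_eq_norm_sq, hν]; norm_num⟩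
  have h2 : MeasurePreserving (fun x : ℝ × (ℝ ∙ ν)ᗮ => (x.1, x.1 • v + x.2))
      (volume.prod volume) (volume.prod volume) :=
    (MeasurePreserving.id volume).skew_product (g := fun t w => t • v + w) (by fun_prop)
      (Eventually.of_forall fun t => (measurePreserving_add_left volume (t • v)).map_eq)
  have h3 := h1.comp ((Measure.measurePreserving_swap).comp
    (h2.comp Measure.measurePreserving_swap))
  have h4 : (fun x : (ℝ ∙ ν)ᗮ × ℝ => (x.1 : E) + x.2 • τ) =
      ((L.toLinearIsometryEquiv hfin) ∘ WithLp.toLp 2) ∘ Prod.swap ∘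
        (fun x : ℝ × (ℝ ∙ ν)ᗮ => (x.1, x.1 • v + x.2)) ∘ Prod.swap := by
    funext x
    change (x.1 : E) + x.2 • τ = ((x.2 • v + x.1 : (ℝ ∙ ν)ᗮ) : E) + x.2 • ν
    simp [v, smul_sub]
    abel
  rw [h4]
  exact h3

end SlantedCoordinates

theorem differentiableAt_of_notMem_tsupport {E A : Type*} [NormedAddCommGroup E] [NormedSpace ℝ E]
    [NormedAddCommGroup A] [NormedSpace ℝ A] {φ : E → A} {y : E} (h : y ∉ tsupport φ) :
    DifferentiableAt ℝ φ y ∧ fderiv ℝ φ y = 0 := by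
  have h0 : φ =ᶠ[𝓝 y] fun _ => 0 := notMem_tsupport_iff_eventuallyEq.1 h
  exact ⟨(differentiableAt_const _).congr_of_eventuallyEq h0, by rw [h0.fderiv_eq]; simp⟩

/-! ### Nearly flat boundaries and integration along transversal lines -/

section Flat

variable {E : Type*} [NormedAddCommGroup E] [InnerProductSpace ℝ E]

/-- In the ball `B(p, r)` the open set `D` is the sublevel set of a function which differs from the
linear function `⟪ν, ·⟫` by a function with Lipschitz constant `δ`. -/
structure IsFlat (D : Set E) (ρ : E → ℝ) (p ν : E) (r δ : ℝ) : Prop where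
  isOpen : IsOpen D
  norm_eq : ‖ν‖ = 1
  mem_iff : ∀ y ∈ Metric.ball p r, (y ∈ D ↔ ρ y < 0)
  flat : ∀ y ∈ Metric.ball p r, ∀ z ∈ Metric.ball p r, |ρ y - ρ z - ⟪ν, y - z⟫| ≤ δ * ‖y - z‖

variable {D : Set E} {ρ : E → ℝ} {p ν : E} {r δ : ℝ}

namespace IsFlat

theorem continuousOn (H : IsFlat D ρ p ν r δ) : ContinuousOn ρ (Metric.ball p r) := by
  have h : LipschitzOnWith (Real.toNNReal (1 + |δ|)) ρ (Metric.ball p r) := by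
    refine LipschitzOnWith.of_dist_le_mul fun y hy z hz => ?_
    rw [Real.coe_toNNReal _ (by positivity), Real.dist_eq, dist_eq_norm]
    have h1 := H.flat y hy z hz
    have h2 : |⟪ν, y - z⟫| ≤ ‖y - z‖ := by
      simpa [H.norm_eq] using abs_real_inner_le_norm ν (y - z)
    have h3 : δ * ‖y - z‖ ≤ |δ| * ‖y - z‖ := by gcongr; exact le_abs_self δ
    rw [abs_le] at *
    constructor <;> linarith
  exact h.continuousOn

/-- The linear part has slope `1` along `τ` and the perturbation at most `δ ‖τ‖ ≤ 1/2`. Hence a line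
in direction `τ` crosses the boundary inside the ball at most once, from inside to outside. -/
theorem add_smul_le (H : IsFlat D ρ p ν r δ) (hδ : δ ≤ 1 / 4) {τ : E}
    (hτ : ⟪ν, τ⟫ = 1) (hτ2 : ‖τ‖ ≤ 2) {y : E} {s t : ℝ} (hst : s ≤ t)
    (hs : y + s • τ ∈ Metric.ball p r) (ht : y + t • τ ∈ Metric.ball p r) :
    ρ (y + s • τ) + (t - s) / 2 ≤ ρ (y + t • τ) := by
  have h1 := H.flat _ ht _ hs
  have h2 : y + t • τ - (y + s • τ) = (t - s) • τ := by rw [sub_smul]; abel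
  rw [h2, inner_smul_right, hτ, norm_smul, Real.norm_eq_abs, abs_of_nonneg (sub_nonneg.2 hst)] at h1
  have h3 : δ * ((t - s) * ‖τ‖) ≤ 1 / 4 * ((t - s) * 2) := by
    have := sub_nonneg.2 hst
    gcongr
  have := (abs_le.1 h1).1
  linarith

theorem mem_frontier_iff (H : IsFlat D ρ p ν r δ) (hδ : δ ≤ 1 / 4) {y : E}
    (hy : y ∈ Metric.ball p r) : y ∈ frontier D ↔ ρ y = 0 := by
  have hball : Metric.ball p r ∈ 𝓝 y := Metric.isOpen_ball.mem_nhds hy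
  rw [H.isOpen.frontier_eq, Set.mem_sdiff, H.mem_iff y hy, not_lt]
  constructor
  · rintro ⟨h1, h2⟩
    refine le_antisymm ?_ h2
    have hc : ContinuousWithinAt ρ (D ∩ Metric.ball p r) y :=
      (H.continuousOn.continuousAt hball).continuousWithinAt
    have h3 : y ∈ closure (D ∩ Metric.ball p r) := by
      rw [inter_comm]
      exact Metric.isOpen_ball.inter_closure ⟨hy, h1⟩
    have : (𝓝[D ∩ Metric.ball p r] y).NeBot := mem_closure_iff_nhdsWithin_neBot.1 h3
    exact le_of_tendsto hc (eventually_mem_nhdsWithin.mono fun z hz =>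
      ((H.mem_iff z hz.2).1 hz.1).le)
  · intro h
    refine ⟨?_, h.ge⟩
    have hνν : ⟪ν, ν⟫ = 1 := by rw [real_inner_self_eq_norm_sq, H.norm_eq]; norm_num
    have hcont : Continuous fun t : ℝ => y + t • ν := by fun_prop
    have ht : Tendsto (fun t : ℝ => y + t • ν) (𝓝[<] 0) (𝓝 y) := by
      have := hcont.tendsto 0
      simp only [zero_smul, add_zero] at this
      exact this.mono_left nhdsWithin_le_nhds
    refine mem_closure_of_tendsto ht ?_
    filter_upwards [ht hball, self_mem_nhdsWithin] with t ht1 ht2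
    rw [H.mem_iff _ ht1]
    have := H.add_smul_le hδ hνν (by rw [H.norm_eq]; norm_num) (y := y) (le_of_lt ht2) ht1
      (by simpa using hy)
    simp only [zero_smul, add_zero, h] at this
    have ht3 : t < 0 := ht2
    linarith

theorem exists_mem_frontier_of_line (H : IsFlat D ρ p ν r δ) (hδ : δ ≤ 1 / 4)
    {τ y : E} {s t : ℝ} (hs : y + s • τ ∈ Metric.ball p r) (ht : y + t • τ ∈ Metric.ball p r)
    (hsD : y + s • τ ∈ D) (htD : y + t • τ ∉ D) :
    ∃ u : ℝ, y + u • τ ∈ frontier D ∩ Metric.ball p r := by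
  have hpre : IsPreconnected {u : ℝ | y + u • τ ∈ Metric.ball p r} := by
    apply Convex.isPreconnected
    intro a ha b hb c d hc hd hcd
    have := (convex_ball p r) ha hb hc hd hcd
    simp only [mem_ofPred_eq]
    convert this using 1
    have hy : y = (c + d) • y := by rw [hcd, one_smul]
    nth_rewrite 1 [hy]
    simp only [smul_add, add_smul, smul_smul, smul_eq_mul]
    abel
  have hcont : ContinuousOn (fun u : ℝ => ρ (y + u • τ)) {u | y + u • τ ∈ Metric.ball p r} :=
    H.continuousOn.comp (by fun_prop) fun u hu => hu
  have h0 : (0 : ℝ) ∈ Icc (ρ (y + s • τ)) (ρ (y + t • τ)) :=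
    ⟨((H.mem_iff _ hs).1 hsD).le, not_lt.1 fun h => htD ((H.mem_iff _ ht).2 h)⟩
  obtain ⟨u, hu, hu0⟩ := hpre.intermediate_value hs ht hcont h0
  exact ⟨u, (H.mem_frontier_iff hδ hu).2 hu0, hu⟩

variable {A : Type*} [NormedAddCommGroup A] [NormedSpace ℝ A]

theorem eventually_line_notMem_ball {τ : E} (hτ : τ ≠ 0) (y p : E) (r : ℝ) :
    (∀ᶠ t : ℝ in atBot, y + t • τ ∉ Metric.ball p r) ∧
      ∀ᶠ t : ℝ in atTop, y + t • τ ∉ Metric.ball p r := by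
  have hτ' : 0 < ‖τ‖ := norm_pos_iff.2 hτ
  have key : ∀ t : ℝ, (r + ‖y - p‖) / ‖τ‖ ≤ |t| → y + t • τ ∉ Metric.ball p r := by
    intro t ht hmem
    rw [div_le_iff₀ hτ'] at ht
    rw [Metric.mem_ball, dist_eq_norm] at hmem
    have h1 : ‖t • τ‖ ≤ ‖y + t • τ - p‖ + ‖y - p‖ := by
      have : t • τ = (y + t • τ - p) - (y - p) := by abel
      calc ‖t • τ‖ = ‖(y + t • τ - p) - (y - p)‖ := by rw [← this]
        _ ≤ _ := norm_sub_le _ _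
    rw [norm_smul, Real.norm_eq_abs] at h1
    linarith
  exact ⟨(tendsto_abs_atBot_atTop.eventually_ge_atTop _).mono key,
    (tendsto_abs_atTop_atTop.eventually_ge_atTop _).mono key⟩

theorem hasDerivAt_line {φ : E → A} {y τ : E} {t : ℝ}
    (h : DifferentiableAt ℝ φ (y + t • τ)) :
    HasDerivAt (fun s : ℝ => φ (y + s • τ)) (fderiv ℝ φ (y + t • τ) τ) t := by
  have h1 : HasDerivAt (fun s : ℝ => y + s • τ) τ t := by
    simpa using ((hasDerivAt_id t).smul_const τ).const_add y
  exact h.hasFDerivAt.comp_hasDerivAt t h1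

variable [CompleteSpace A]

/-- On the part of the line inside the ball, `D` is the set `t < t₀`, and `φ` vanishes off the ball,
so this is the fundamental theorem of calculus on `(-∞, t₀]`. -/
theorem integral_line_of_mem (H : IsFlat D ρ p ν r δ) (hδ : δ ≤ 1 / 4)
    {τ : E} (hτ : ⟪ν, τ⟫ = 1) (hτ2 : ‖τ‖ ≤ 2) {φ : E → A} (hc : ContinuousOn φ (closure D))
    (hd : DifferentiableOn ℝ φ D) (hs : tsupport φ ⊆ Metric.ball p r) {y : E}
    (hint : Integrable fun t : ℝ => D.indicator (fun z => fderiv ℝ φ z τ) (y + t • τ)) {t₀ : ℝ}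
    (ht₀ : y + t₀ • τ ∈ frontier D ∩ Metric.ball p r) :
    ∫ t : ℝ, D.indicator (fun z => fderiv ℝ φ z τ) (y + t • τ) = φ (y + t₀ • τ) := by
  have hτ0 : τ ≠ 0 := by rintro rfl; simp at hτ
  have hρ0 : ρ (y + t₀ • τ) = 0 := (H.mem_frontier_iff hδ ht₀.2).1 ht₀.1
  have hlt : ∀ t < t₀, y + t • τ ∈ Metric.ball p r → y + t • τ ∈ D := by
    intro t ht hb
    have := H.add_smul_le hδ hτ hτ2 ht.le hb ht₀.2
    exact (H.mem_iff _ hb).2 (by linarith)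
  have hgt : ∀ t, t₀ ≤ t → y + t • τ ∈ Metric.ball p r → y + t • τ ∉ D := by
    intro t ht hb hD
    have := H.add_smul_le hδ hτ hτ2 ht ht₀.2 hb
    have := (H.mem_iff _ hb).1 hD
    linarith
  have h1 : ∫ t in Iic t₀, D.indicator (fun z => fderiv ℝ φ z τ) (y + t • τ) =
      ∫ t : ℝ, D.indicator (fun z => fderiv ℝ φ z τ) (y + t • τ) := by
    apply setIntegral_eq_integral_of_forall_compl_eq_zero
    intro t ht
    by_cases hb : y + t • τ ∈ Metric.ball p r
    · rw [indicator_of_notMem (hgt t (not_le.1 ht).le hb)]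
    · refine indicator_apply_eq_zero.2 fun _ => ?_
      rw [(differentiableAt_of_notMem_tsupport fun h => hb (hs h)).2]
      simp
  rw [← h1, integral_Iic_of_hasDerivAt_of_tendsto (f := fun t => φ (y + t • τ)) (m := 0) ?_ ?_
    hint.integrableOn ?_, sub_zero]
  · have hev : ∀ᶠ t in 𝓝[Iio t₀] t₀, y + t • τ ∈ D := by
      have hcont : Tendsto (fun t : ℝ => y + t • τ) (𝓝[Iio t₀] t₀) (𝓝 (y + t₀ • τ)) :=
        (Continuous.tendsto (by fun_prop) t₀).mono_left nhdsWithin_le_nhds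
      filter_upwards [hcont (Metric.isOpen_ball.mem_nhds ht₀.2), self_mem_nhdsWithin]
        with t h1 h2 using hlt t h2 h1
    rw [← continuousWithinAt_Iio_iff_Iic]
    -- Continuity of `φ` is known only within the closure of `D`, so the limit at `t₀` has to be
    -- taken from the left, along points of `D`.
    have hmem : y + t₀ • τ ∈ closure D := frontier_subset_closure ht₀.1
    refine (hc _ hmem).tendsto.comp (tendsto_nhdsWithin_iff.2 ⟨?_, hev.mono fun t ht =>
      subset_closure ht⟩)
    exact (Continuous.tendsto (by fun_prop) t₀).mono_left nhdsWithin_le_nhds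
  · intro t ht
    by_cases hb : y + t • τ ∈ Metric.ball p r
    · have hD := hlt t ht hb
      rw [indicator_of_mem hD]
      exact hasDerivAt_line (hd.differentiableAt (H.isOpen.mem_nhds hD))
    · have h2 := differentiableAt_of_notMem_tsupport (φ := φ) fun h => hb (hs h)
      have h3 := hasDerivAt_line h2.1
      rw [h2.2] at h3
      have h4 : D.indicator (fun z => fderiv ℝ φ z τ) (y + t • τ) = 0 :=
        indicator_apply_eq_zero.2 fun _ => by rw [h2.2]; simp
      simpa [h4] using h3
  · refine tendsto_const_nhds.congr' ?_
    filter_upwards [(eventually_line_notMem_ball hτ0 y p r).1] with t ht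
    exact (image_eq_zero_of_notMem_tsupport fun h => ht (hs h)).symm

/-- A line that misses the boundary inside the ball has its portion there wholly in `D` or wholly
outside. In the first case `φ` is differentiable along the line and vanishes at both ends; in the
second the integrand is zero. -/
theorem integral_line_of_notMem (H : IsFlat D ρ p ν r δ) (hδ : δ ≤ 1 / 4)
    {τ : E} (hτ : ⟪ν, τ⟫ = 1) {φ : E → A}
    (hd : DifferentiableOn ℝ φ D) (hs : tsupport φ ⊆ Metric.ball p r) {y : E}
    (hint : Integrable fun t : ℝ => D.indicator (fun z => fderiv ℝ φ z τ) (y + t • τ))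
    (hy : ∀ t : ℝ, y + t • τ ∉ frontier D ∩ Metric.ball p r) :
    ∫ t : ℝ, D.indicator (fun z => fderiv ℝ φ z τ) (y + t • τ) = 0 := by
  have hτ0 : τ ≠ 0 := by rintro rfl; simp at hτ
  have houtside : ∀ t : ℝ, y + t • τ ∉ Metric.ball p r →
      D.indicator (fun z => fderiv ℝ φ z τ) (y + t • τ) = 0 := by
    intro t hb
    refine indicator_apply_eq_zero.2 fun _ => ?_
    rw [(differentiableAt_of_notMem_tsupport fun h => hb (hs h)).2]
    simp
  by_cases hex : ∃ s : ℝ, y + s • τ ∈ Metric.ball p r ∧ y + s • τ ∈ D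
  · obtain ⟨s, hs1, hs2⟩ := hex
    have hall : ∀ t : ℝ, y + t • τ ∈ Metric.ball p r → y + t • τ ∈ D := by
      intro t ht
      by_contra hD
      obtain ⟨u, hu⟩ := H.exists_mem_frontier_of_line hδ hs1 ht hs2 hD
      exact hy u hu
    rw [integral_of_hasDerivAt_of_tendsto (f := fun t => φ (y + t • τ)) (m := 0) (n := 0) ?_
      hint ?_ ?_, sub_zero]
    · intro t
      by_cases hb : y + t • τ ∈ Metric.ball p r
      · have hD := hall t hb
        rw [indicator_of_mem hD]
        exact hasDerivAt_line (hd.differentiableAt (H.isOpen.mem_nhds hD))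
      · have h2 := differentiableAt_of_notMem_tsupport (φ := φ) fun h => hb (hs h)
        have h3 := hasDerivAt_line h2.1
        rw [houtside t hb]
        rw [h2.2] at h3
        simpa using h3
    · refine tendsto_const_nhds.congr' ?_
      filter_upwards [(eventually_line_notMem_ball hτ0 y p r).1] with t ht
      exact (image_eq_zero_of_notMem_tsupport fun h => ht (hs h)).symm
    · refine tendsto_const_nhds.congr' ?_
      filter_upwards [(eventually_line_notMem_ball hτ0 y p r).2] with t ht
      exact (image_eq_zero_of_notMem_tsupport fun h => ht (hs h)).symm
  · push Not at hex
    refine integral_eq_zero_of_ae (Eventually.of_forall fun t => ?_)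
    by_cases hb : y + t • τ ∈ Metric.ball p r
    · exact indicator_of_notMem (hex t hb) _
    · exact houtside t hb

end IsFlat

end Flat

/-! ### Comparison of Hausdorff measures and of integrals -/

section MeasureComparison

theorem euclideanHausdorffMeasure_image_le {X Y : Type*} [EMetricSpace X] [MeasurableSpace X]
    [BorelSpace X] [EMetricSpace Y] [MeasurableSpace Y] [BorelSpace Y] {K : ℝ≥0} {f : X → Y}
    {s : Set X} (h : LipschitzOnWith K f s) (d : ℕ) :
    μHE[d] (f '' s) ≤ (K : ℝ≥0∞) ^ d * μHE[d] s := by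
  have h1 := h.hausdorffMeasure_image_le (d := d) (by positivity)
  rw [ENNReal.rpow_natCast] at h1
  simp only [Measure.euclideanHausdorffMeasure_def, Measure.smul_apply, ENNReal.smul_def,
    smul_eq_mul]
  rw [mul_left_comm]
  gcongr

theorem le_euclideanHausdorffMeasure_image {X Y : Type*} [EMetricSpace X] [MeasurableSpace X]
    [BorelSpace X] [EMetricSpace Y] [MeasurableSpace Y] [BorelSpace Y] {K : ℝ≥0} {f : X → Y}
    (h : AntilipschitzWith K f) (d : ℕ) (s : Set X) :
    μHE[d] s ≤ (K : ℝ≥0∞) ^ d * μHE[d] (f '' s) := by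
  have h1 := h.le_hausdorffMeasure_image (d := d) (by positivity) s
  rw [ENNReal.rpow_natCast] at h1
  simp only [Measure.euclideanHausdorffMeasure_def, Measure.smul_apply, ENNReal.smul_def,
    smul_eq_mul]
  rw [mul_left_comm]
  gcongr

/-- If two finite measures are comparable up to a factor `1 + ε`, then so are their integrals. -/
theorem norm_integral_sub_integral_le {X A : Type*} [MeasurableSpace X] [NormedAddCommGroup A]
    [NormedSpace ℝ A] {μ m : Measure X} [IsFiniteMeasure μ] {ε : ℝ} (hε : 0 ≤ ε)
    (h1 : m ≤ ENNReal.ofReal (1 + ε) • μ) (h2 : μ ≤ ENNReal.ofReal (1 + ε) • m) {φ : X → A}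
    (hφ : Integrable φ μ) : ‖∫ x, φ x ∂m - ∫ x, φ x ∂μ‖ ≤ 3 * ε * ∫ x, ‖φ x‖ ∂μ := by
  set C : ℝ := 1 + ε with hC
  have hC0 : 0 < C := by positivity
  set c : ℝ := C⁻¹ with hc
  have hc0 : 0 < c := by positivity
  have hle : ENNReal.ofReal c • μ ≤ m := by
    calc ENNReal.ofReal c • μ ≤ ENNReal.ofReal c • (ENNReal.ofReal C • m) := by gcongr
      _ = m := by
        rw [smul_smul, ← ENNReal.ofReal_mul hc0.le, hc, inv_mul_cancel₀ hC0.ne']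
        simp
  have hφm : Integrable φ m := (hφ.smul_measure ENNReal.ofReal_ne_top).mono_measure h1
  have : IsFiniteMeasure (ENNReal.ofReal c • μ) := ⟨by
    simp [ENNReal.mul_lt_top_iff]⟩
  -- Splitting `m = D + c μ` with `D` a positive measure reduces the estimate to `∫ ‖φ‖ dD ≤ (C - c)
  -- ∫ ‖φ‖ dμ`; no density is needed.
  set D := m - ENNReal.ofReal c • μ with hD
  have hsum : D + ENNReal.ofReal c • μ = m := Measure.sub_add_cancel_of_le hle
  have hDm : D ≤ m := by rw [← hsum]; exact Measure.le_add_right le_rfl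
  have hφD : Integrable φ D := hφm.mono_measure hDm
  have hφc : Integrable φ (ENNReal.ofReal c • μ) := hφ.smul_measure ENNReal.ofReal_ne_top
  have e1 : ∫ x, φ x ∂m = ∫ x, φ x ∂D + c • ∫ x, φ x ∂μ := by
    rw [← hsum, integral_add_measure hφD hφc, integral_smul_measure, ENNReal.toReal_ofReal hc0.le]
  have e2 : ∫ x, ‖φ x‖ ∂m = ∫ x, ‖φ x‖ ∂D + c * ∫ x, ‖φ x‖ ∂μ := by
    rw [← hsum, integral_add_measure hφD.norm hφc.norm, integral_smul_measure,
      ENNReal.toReal_ofReal hc0.le, smul_eq_mul]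
  have e3 : ∫ x, ‖φ x‖ ∂m ≤ C * ∫ x, ‖φ x‖ ∂μ := by
    have h3 := integral_mono_measure h1 (Eventually.of_forall fun x => norm_nonneg (φ x))
      (hφ.smul_measure ENNReal.ofReal_ne_top).norm
    rwa [integral_smul_measure, ENNReal.toReal_ofReal hC0.le, smul_eq_mul] at h3
  have e4 : ‖∫ x, φ x ∂D‖ ≤ (C - c) * ∫ x, ‖φ x‖ ∂μ := by
    refine (norm_integral_le_integral_norm _).trans ?_
    linarith
  have hN : 0 ≤ ∫ x, ‖φ x‖ ∂μ := integral_nonneg fun x => norm_nonneg _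
  have e5 : ‖∫ x, φ x ∂μ‖ ≤ ∫ x, ‖φ x‖ ∂μ := norm_integral_le_integral_norm _
  have hcε : 1 - c ≤ ε := by
    have : 1 - c = ε * c := by rw [hc]; field_simp; rw [hC]; ring
    rw [this]
    have : c ≤ 1 := inv_le_one_of_one_le₀ (by linarith)
    nlinarith
  have hc1 : 0 ≤ 1 - c := by
    have : c ≤ 1 := inv_le_one_of_one_le₀ (by linarith)
    linarith
  have e6 : ∫ x, φ x ∂m - ∫ x, φ x ∂μ = ∫ x, φ x ∂D - (1 - c) • ∫ x, φ x ∂μ := by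
    rw [e1, sub_smul, one_smul]; abel
  rw [e6]
  calc ‖∫ x, φ x ∂D - (1 - c) • ∫ x, φ x ∂μ‖ ≤ ‖∫ x, φ x ∂D‖ + ‖(1 - c) • ∫ x, φ x ∂μ‖ :=
        norm_sub_le _ _
    _ ≤ (C - c) * ∫ x, ‖φ x‖ ∂μ + (1 - c) * ∫ x, ‖φ x‖ ∂μ := by
        rw [norm_smul, Real.norm_of_nonneg hc1]
        gcongr
    _ = ((C - c) + (1 - c)) * ∫ x, ‖φ x‖ ∂μ := by ring
    _ ≤ 3 * ε * ∫ x, ‖φ x‖ ∂μ := by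
        gcongr
        linarith

theorem euclideanHausdorffMeasure_subtype {E : Type*} [EMetricSpace E] [MeasurableSpace E]
    [BorelSpace E] {d : ℕ} (s t : Set E) :
    μHE[d] (Subtype.val ⁻¹' s : Set t) = μHE[d] (s ∩ t) := by
  rw [isometry_subtype_coe.euclideanHausdorffMeasure_preimage, Subtype.range_coe]

theorem measurableSet_boundary {E : Type*} [PseudoMetricSpace E] [MeasurableSpace E]
    [OpensMeasurableSpace E] (D : Set E) (p : E) (r : ℝ) :
    MeasurableSet (frontier D ∩ Metric.ball p r) :=
  isClosed_frontier.measurableSet.inter measurableSet_ball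

end MeasureComparison

/-! ### Projection of a nearly flat boundary and the local divergence estimate -/

section FlatBoundary

variable {E : Type*} [NormedAddCommGroup E] [InnerProductSpace ℝ E]
  {D : Set E} {ρ : E → ℝ} {p ν τ : E} {r δ : ℝ}

namespace IsFlat

/-- Since `ρ` vanishes at both boundary points, flatness bounds `⟪ν, y - z⟫` by `δ ‖y - z‖`, and the
projection changes `y - z` only by this multiple of `τ`. -/
theorem norm_slantProj_sub (H : IsFlat D ρ p ν r δ) (hδ : δ ≤ 1 / 4) (hτ : ⟪ν, τ⟫ = 1)
    (hτ2 : ‖τ‖ ≤ 2) {y z : E} (hy : y ∈ frontier D ∩ Metric.ball p r)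
    (hz : z ∈ frontier D ∩ Metric.ball p r) :
    (1 - 2 * δ) * ‖y - z‖ ≤ ‖slantProj ν τ y - slantProj ν τ z‖ ∧
      ‖slantProj ν τ y - slantProj ν τ z‖ ≤ (1 + 2 * δ) * ‖y - z‖ := by
  have h1 := H.flat y hy.2 z hz.2
  rw [(H.mem_frontier_iff hδ hy.2).1 hy.1, (H.mem_frontier_iff hδ hz.2).1 hz.1] at h1
  simp only [sub_self, zero_sub, abs_neg] at h1
  have h2 : ‖slantProj ν τ y - slantProj ν τ z‖ = ‖(y - z) - ⟪ν, y - z⟫ • τ‖ := by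
    rw [← map_sub, ← slantProj_coe hτ]; rfl
  have h3 : ‖⟪ν, y - z⟫ • τ‖ ≤ 2 * δ * ‖y - z‖ := by
    rw [norm_smul, Real.norm_eq_abs]
    calc |⟪ν, y - z⟫| * ‖τ‖ ≤ (δ * ‖y - z‖) * 2 :=
          mul_le_mul h1 hτ2 (norm_nonneg _) ((abs_nonneg _).trans h1)
      _ = _ := by ring
  rw [h2]
  have h4 := norm_sub_norm_le (y - z) (⟪ν, y - z⟫ • τ)
  have h5 := norm_sub_le (y - z) (⟪ν, y - z⟫ • τ)
  constructor <;> linarith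

theorem injOn_slantProj (H : IsFlat D ρ p ν r δ) (hδ : δ ≤ 1 / 4) (hτ : ⟪ν, τ⟫ = 1)
    (hτ2 : ‖τ‖ ≤ 2) : InjOn (slantProj ν τ) (frontier D ∩ Metric.ball p r) := by
  intro y hy z hz h
  have h1 := (H.norm_slantProj_sub hδ hτ hτ2 hy hz).1
  rw [h, sub_self, norm_zero] at h1
  have h2 : 0 < 1 - 2 * δ := by linarith
  have h3 : ‖y - z‖ ≤ 0 := by
    by_contra h0
    push Not at h0
    exact absurd h1 (not_le.2 (by positivity))
  exact sub_eq_zero.1 (norm_le_zero_iff.1 h3)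

variable [FiniteDimensional ℝ E] [MeasurableSpace E] [BorelSpace E]

/-- The Lebesgue measure of `ν^⊥`, transported to the boundary by the slanted projection. -/
noncomputable def slantMeasure (D : Set E) (p ν τ : E) (r : ℝ) : Measure E :=
  (Measure.comap ((frontier D ∩ Metric.ball p r).domRestrict (slantProj ν τ))
    (volume : Measure (ℝ ∙ ν)ᗮ)).map Subtype.val

theorem measurableEmbedding_slantProj (H : IsFlat D ρ p ν r δ) (hδ : δ ≤ 1 / 4)
    (hτ : ⟪ν, τ⟫ = 1) (hτ2 : ‖τ‖ ≤ 2) :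
    MeasurableEmbedding ((frontier D ∩ Metric.ball p r).domRestrict (slantProj ν τ)) := by
  have : CompleteSpace E := FiniteDimensional.complete ℝ E
  exact (slantProj ν τ).continuous.continuousOn.measurableEmbedding
    (measurableSet_boundary D p r) (H.injOn_slantProj hδ hτ hτ2)

theorem slantMeasure_apply (H : IsFlat D ρ p ν r δ) (hδ : δ ≤ 1 / 4)
    (hτ : ⟪ν, τ⟫ = 1) (hτ2 : ‖τ‖ ≤ 2) (s : Set E) :
    slantMeasure D p ν τ r s =
      volume ((frontier D ∩ Metric.ball p r).domRestrict (slantProj ν τ) ''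
        (Subtype.val ⁻¹' s)) := by
  rw [slantMeasure, (MeasurableEmbedding.subtype_coe (measurableSet_boundary D p r)).map_apply,
    (H.measurableEmbedding_slantProj hδ hτ hτ2).comap_apply]

theorem euclideanHausdorffMeasure_orthogonal {d : ℕ} (hd : finrank ℝ E = d + 1) (hν : ‖ν‖ = 1) :
    (volume : Measure (ℝ ∙ ν)ᗮ) = μHE[d] := by
  have : Fact (finrank ℝ E = d + 1) := ⟨hd⟩
  have hν0 : ν ≠ 0 := by rintro rfl; simp at hν
  rw [← InnerProductSpace.euclideanHausdorffMeasure_eq_volume,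
    Submodule.finrank_orthogonal_span_singleton (n := d) hν0]

theorem slantMeasure_le (H : IsFlat D ρ p ν r δ) (hδ0 : 0 ≤ δ) (hδ : δ ≤ 1 / 4)
    (hτ : ⟪ν, τ⟫ = 1) (hτ2 : ‖τ‖ ≤ 2) {d : ℕ} (hd : finrank ℝ E = d + 1) :
    slantMeasure D p ν τ r ≤ ENNReal.ofReal ((1 + 4 * δ) ^ d) •
      (μHE[d]).restrict (frontier D ∩ Metric.ball p r) := by
  refine Measure.le_intro fun s hs _ => ?_
  have hlip : LipschitzWith (Real.toNNReal (1 + 4 * δ))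
      ((frontier D ∩ Metric.ball p r).domRestrict (slantProj ν τ)) := by
    refine LipschitzWith.of_dist_le_mul fun y z => ?_
    rw [Real.coe_toNNReal _ (by positivity), dist_eq_norm, Subtype.dist_eq, dist_eq_norm]
    refine (H.norm_slantProj_sub hδ hτ hτ2 y.2 z.2).2.trans ?_
    gcongr
    linarith
  rw [H.slantMeasure_apply hδ hτ hτ2, euclideanHausdorffMeasure_orthogonal hd H.norm_eq]
  refine (euclideanHausdorffMeasure_image_le hlip.lipschitzOnWith d).trans_eq ?_
  rw [euclideanHausdorffMeasure_subtype, Measure.smul_apply, Measure.restrict_apply hs,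
    smul_eq_mul, ENNReal.ofReal_pow (by positivity)]
  rfl

theorem le_slantMeasure (H : IsFlat D ρ p ν r δ) (hδ0 : 0 ≤ δ) (hδ : δ ≤ 1 / 4)
    (hτ : ⟪ν, τ⟫ = 1) (hτ2 : ‖τ‖ ≤ 2) {d : ℕ} (hd : finrank ℝ E = d + 1) :
    (μHE[d]).restrict (frontier D ∩ Metric.ball p r) ≤ ENNReal.ofReal ((1 + 4 * δ) ^ d) •
      slantMeasure D p ν τ r := by
  refine Measure.le_intro fun s hs _ => ?_
  have hlip : AntilipschitzWith (Real.toNNReal (1 + 4 * δ))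
      ((frontier D ∩ Metric.ball p r).domRestrict (slantProj ν τ)) := by
    refine AntilipschitzWith.of_le_mul_dist fun y z => ?_
    rw [Real.coe_toNNReal _ (by positivity), dist_eq_norm, Subtype.dist_eq, dist_eq_norm]
    have h1 := (H.norm_slantProj_sub hδ hτ hτ2 y.2 z.2).1
    have h2 : (1 + 4 * δ) * ((1 - 2 * δ) * ‖(y : E) - z‖) ≤ (1 + 4 * δ) *
        ‖slantProj ν τ y - slantProj ν τ z‖ := by gcongr
    refine le_trans ?_ h2
    rw [← mul_assoc]
    refine le_mul_of_one_le_left (norm_nonneg _) ?_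
    -- This is `(1 + 4δ)(1 - 2δ) = 1 + 2δ(1 - 4δ) ≥ 1`, where `δ ≤ 1/4` is used to the full.
    nlinarith
  rw [Measure.smul_apply, H.slantMeasure_apply hδ hτ hτ2,
    euclideanHausdorffMeasure_orthogonal hd H.norm_eq, Measure.restrict_apply hs,
    ← euclideanHausdorffMeasure_subtype, smul_eq_mul, ENNReal.ofReal_pow (by positivity)]
  exact le_euclideanHausdorffMeasure_image hlip d _

theorem slantMeasure_univ_lt_top (H : IsFlat D ρ p ν r δ) (hδ : δ ≤ 1 / 4)
    (hτ : ⟪ν, τ⟫ = 1) (hτ2 : ‖τ‖ ≤ 2) : slantMeasure D p ν τ r univ < ⊤ := by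
  rw [H.slantMeasure_apply hδ hτ hτ2]
  refine Bornology.IsBounded.measure_lt_top ?_
  refine ((slantProj ν τ).lipschitz.isBounded_image
    (Metric.isBounded_ball (x := p) (r := r))).subset ?_
  rintro _ ⟨y, -, rfl⟩
  exact ⟨y, y.2.2, rfl⟩

theorem euclideanHausdorffMeasure_lt_top (H : IsFlat D ρ p ν r δ) (hδ0 : 0 ≤ δ) (hδ : δ ≤ 1 / 4)
    {d : ℕ} (hd : finrank ℝ E = d + 1) : μHE[d] (frontier D ∩ Metric.ball p r) < ⊤ := by
  have hνν : ⟪ν, ν⟫ = 1 := by rw [real_inner_self_eq_norm_sq, H.norm_eq]; norm_num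
  have hν2 : ‖ν‖ ≤ 2 := by rw [H.norm_eq]; norm_num
  have h1 := H.le_slantMeasure hδ0 hδ hνν hν2 hd univ
  rw [Measure.restrict_apply_univ] at h1
  exact h1.trans_lt (ENNReal.mul_lt_top ENNReal.ofReal_lt_top
    (H.slantMeasure_univ_lt_top hδ hνν hν2))

variable {A : Type*} [NormedAddCommGroup A] [NormedSpace ℝ A] [CompleteSpace A]

/-- Fubini in slanted coordinates: the integral over the line through `w` is the value of `φ` at its
boundary point if `w` lies in the projection of the boundary piece, and zero otherwise. The identity
is exact; errors enter only when the projected measure is replaced by Hausdorff measure. -/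
theorem integral_fderiv_eq_integral_slantMeasure (H : IsFlat D ρ p ν r δ) (hδ : δ ≤ 1 / 4)
    (hτ : ⟪ν, τ⟫ = 1) (hτ2 : ‖τ‖ ≤ 2) {φ : E → A} (hc : ContinuousOn φ (closure D))
    (hd : DifferentiableOn ℝ φ D) (hs : tsupport φ ⊆ Metric.ball p r)
    (hint : IntegrableOn (fun y => fderiv ℝ φ y τ) D) :
    ∫ y in D, fderiv ℝ φ y τ = ∫ y, φ y ∂(slantMeasure D p ν τ r) := by
  have : CompleteSpace E := FiniteDimensional.complete ℝ E
  set g := D.indicator (fun y => fderiv ℝ φ y τ) with hg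
  have hgint : Integrable g := hint.integrable_indicator H.isOpen.measurableSet
  have hΨ := measurePreserving_slanted H.norm_eq hτ
  have hemb : MeasurableEmbedding (fun x : (ℝ ∙ ν)ᗮ × ℝ => (x.1 : E) + x.2 • τ) := by
    refine Continuous.measurableEmbedding (by fun_prop) fun x y hxy => ?_
    have h1 := congrArg (slantProj ν τ) hxy
    simp only [slantProj_add_smul hτ] at h1
    have h2 : ⟪ν, (x.1 : E) + x.2 • τ⟫ = ⟪ν, (y.1 : E) + y.2 • τ⟫ := congrArg _ hxy
    simp only [inner_add_right, inner_smul_right, hτ,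
      Submodule.mem_orthogonal_singleton_iff_inner_right.1 (Subtype.prop _)] at h2
    exact Prod.ext h1 (by simpa using h2)
  have hgint2 : Integrable (fun x : (ℝ ∙ ν)ᗮ × ℝ => g ((x.1 : E) + x.2 • τ))
      (volume.prod volume) := (hΨ.integrable_comp_emb hemb).2 hgint
  set e := (frontier D ∩ Metric.ball p r).domRestrict (slantProj ν τ) with he
  have hemb' : MeasurableEmbedding e := H.measurableEmbedding_slantProj hδ hτ hτ2
  have hline : ∀ᵐ w : (ℝ ∙ ν)ᗮ, Integrable (fun t : ℝ => g ((w : E) + t • τ)) :=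
    hgint2.prod_right_ae
  rw [← integral_indicator H.isOpen.measurableSet, ← hg, ← hΨ.integral_comp hemb]
  change ∫ x : (ℝ ∙ ν)ᗮ × ℝ, g ((x.1 : E) + x.2 • τ) ∂(volume.prod volume) = _
  rw [integral_prod _ hgint2]
  have h1 : ∫ w : (ℝ ∙ ν)ᗮ, ∫ t : ℝ, g ((w : E) + t • τ) =
      ∫ w in range e, ∫ t : ℝ, g ((w : E) + t • τ) := by
    rw [eq_comm, ← integral_indicator hemb'.measurableSet_range]
    refine integral_congr_ae (hline.mono fun w hw => ?_)
    by_cases hwr : w ∈ range e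
    · simp [hwr]
    · simp only [indicator_of_notMem hwr]
      refine (H.integral_line_of_notMem hδ hτ hd hs hw fun t ht => hwr ⟨⟨_, ht⟩, ?_⟩).symm
      exact slantProj_add_smul hτ w t
  rw [h1, ← hemb'.map_comap, hemb'.integral_map, slantMeasure,
    (MeasurableEmbedding.subtype_coe (measurableSet_boundary D p r)).integral_map, ← he]
  have hline' : ∀ᵐ y ∂(Measure.comap e volume), Integrable (fun t : ℝ => g ((e y : E) + t • τ)) := by
    refine (hemb'.ae_map_iff (p := fun w => Integrable (fun t : ℝ => g ((w : E) + t • τ)))).1 ?_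
    rw [hemb'.map_comap]
    exact ae_restrict_of_ae hline
  refine integral_congr_ae (hline'.mono fun y hy => ?_)
  have hy0 : (e y : E) + ⟪ν, (y : E)⟫ • τ = y := slantProj_add hτ y
  have h2 := H.integral_line_of_mem hδ hτ hτ2 hc hd hs hy (t₀ := ⟪ν, (y : E)⟫)
    (by rw [hy0]; exact y.2)
  rw [hy0] at h2
  exact h2

theorem norm_integral_fderiv_sub_le (H : IsFlat D ρ p ν r δ) (hδ0 : 0 ≤ δ) (hδ : δ ≤ 1 / 4)
    (hτ : ⟪ν, τ⟫ = 1) (hτ2 : ‖τ‖ ≤ 2) {d : ℕ} (hdim : finrank ℝ E = d + 1) {ε : ℝ} (hε : 0 ≤ ε)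
    (hδε : (1 + 4 * δ) ^ d ≤ 1 + ε) {φ : E → A} (hc : ContinuousOn φ (closure D))
    (hd : DifferentiableOn ℝ φ D) (hs : tsupport φ ⊆ Metric.ball p r)
    (hint : IntegrableOn (fun y => fderiv ℝ φ y τ) D)
    (hφ : IntegrableOn φ (frontier D) μHE[d]) :
    ‖(∫ y in D, fderiv ℝ φ y τ) - ∫ y in frontier D, φ y ∂μHE[d]‖ ≤
      3 * ε * ∫ y in frontier D, ‖φ y‖ ∂μHE[d] := by
  have h0 : ∀ y ∈ frontier D \ (frontier D ∩ Metric.ball p r), φ y = 0 := fun y hy =>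
    image_eq_zero_of_notMem_tsupport fun h => hy.2 ⟨hy.1, hs h⟩
  rw [setIntegral_eq_of_subset_of_forall_sdiff_eq_zero isClosed_frontier.measurableSet
      inter_subset_left h0,
    setIntegral_eq_of_subset_of_forall_sdiff_eq_zero isClosed_frontier.measurableSet
      inter_subset_left (fun y hy => by rw [h0 y hy, norm_zero]),
    H.integral_fderiv_eq_integral_slantMeasure hδ hτ hτ2 hc hd hs hint]
  have : IsFiniteMeasure ((μHE[d]).restrict (frontier D ∩ Metric.ball p r)) :=
    ⟨by rw [Measure.restrict_apply_univ]; exact H.euclideanHausdorffMeasure_lt_top hδ0 hδ hdim⟩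
  refine norm_integral_sub_integral_le hε ?_ ?_ (hφ.mono_set inter_subset_left)
  · refine (H.slantMeasure_le hδ0 hδ hτ hτ2 hdim).trans ?_
    gcongr
  · refine (H.le_slantMeasure hδ0 hδ hτ hτ2 hdim).trans ?_
    gcongr

end IsFlat

end FlatBoundary

namespace IsFlat

/-- Otherwise a short step from `q` in the direction `ν' - ν` would lie in `D` according to `ρ` and
outside `D` according to `ρ'`: the slopes are `∓‖ν' - ν‖²/2`, and they beat the flatness error `δ
‖ν' - ν‖`. -/
theorem norm_normal_sub_le {E : Type*} [NormedAddCommGroup E] [InnerProductSpace ℝ E]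
    {D : Set E} {ρ ρ' : E → ℝ} {p q ν ν' : E} {r r' δ : ℝ} (H : IsFlat D ρ p ν r δ)
    (H' : IsFlat D ρ' q ν' r' δ) (hδ0 : 0 ≤ δ) (hδ : δ ≤ 1 / 4) (hr' : 0 < r')
    (hq : q ∈ frontier D ∩ Metric.ball p r) : ‖ν' - ν‖ ≤ 2 * δ := by
  by_contra! hlt
  set v := ν' - ν with hv
  have hρ : ρ q = 0 := (H.mem_frontier_iff hδ hq.2).1 hq.1
  have hρ' : ρ' q = 0 := (H'.mem_frontier_iff hδ (Metric.mem_ball_self hr')).1 hq.1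
  have hcont : Tendsto (fun t : ℝ => q + t • v) (𝓝[>] 0) (𝓝 q) := by
    have : Tendsto (fun t : ℝ => q + t • v) (𝓝 0) (𝓝 (q + (0 : ℝ) • v)) :=
      Continuous.tendsto (by fun_prop) 0
    rw [zero_smul, add_zero] at this
    exact this.mono_left nhdsWithin_le_nhds
  obtain ⟨t, ⟨ht1, ht2⟩, ht0⟩ := (((hcont.eventually_mem
    (Metric.isOpen_ball.mem_nhds hq.2)).and (hcont.eventually_mem
    (Metric.ball_mem_nhds q hr'))).and self_mem_nhdsWithin).exists
  have ht0 : 0 < t := ht0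
  have hvv : ⟪ν, v⟫ = -(‖v‖ ^ 2 / 2) ∧ ⟪ν', v⟫ = ‖v‖ ^ 2 / 2 := by
    have h1 : ‖v‖ ^ 2 = 1 - 2 * ⟪ν', ν⟫ + 1 := by
      rw [hv, norm_sub_sq_real, H.norm_eq, H'.norm_eq]; ring
    rw [h1, hv, inner_sub_right, inner_sub_right, real_inner_self_eq_norm_sq,
      real_inner_self_eq_norm_sq, H.norm_eq, H'.norm_eq, real_inner_comm ν' ν]
    constructor <;> ring
  have h1 := H.flat _ ht1 _ hq.2
  have h2 := H'.flat _ ht2 _ (Metric.mem_ball_self hr')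
  rw [add_sub_cancel_left, inner_smul_right, norm_smul, Real.norm_of_nonneg ht0.le] at h1 h2
  rw [hvv.1, hρ] at h1
  rw [hvv.2, hρ'] at h2
  have hpos : 0 < t * (‖v‖ ^ 2 / 2 - δ * ‖v‖) := by
    refine mul_pos ht0 ?_
    have : 0 < ‖v‖ := by linarith
    nlinarith
  have h3 : ρ (q + t • v) < 0 := by
    have := (abs_le.1 h1).2
    linarith
  have h4 : 0 < ρ' (q + t • v) := by
    have := (abs_le.1 h2).1
    linarith
  exact absurd ((H'.mem_iff _ ht2).1 ((H.mem_iff _ ht1).2 h3)) h4.le.not_gt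

end IsFlat

/-! ### Functions of class `C¹` on the closure of a bounded open set -/

section ContDiffOnClosure

variable {E : Type*} [NormedAddCommGroup E] [NormedSpace ℝ E] {A : Type*} [NormedAddCommGroup A]
  [NormedSpace ℝ A] {D : Set E} {φ : E → A}

/-- At a boundary point `fderiv` may carry no information, but the derivative within the closure is
continuous there, hence locally bounded, and it agrees with `fderiv` at nearby points of `D`.
Compactness of the closure makes the bound uniform. -/
theorem exists_norm_fderiv_le [ProperSpace E] (hD : IsOpen D) (hb : Bornology.IsBounded D)
    (hφ : ContDiffOn ℝ 1 φ (closure D)) : ∃ C, ∀ y ∈ D, ‖fderiv ℝ φ y‖ ≤ C := by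
  have hcomp : IsCompact (closure D) := hb.isCompact_closure
  suffices h : ∃ C, ∀ y ∈ closure D ∩ D, ‖fderiv ℝ φ y‖ ≤ C by
    obtain ⟨C, hC⟩ := h
    exact ⟨C, fun y hy => hC y ⟨subset_closure hy, hy⟩⟩
  refine hcomp.induction_on (p := fun s => ∃ C, ∀ y ∈ s ∩ D, ‖fderiv ℝ φ y‖ ≤ C) ⟨0, by simp⟩
    ?_ ?_ ?_
  · rintro s t hst ⟨C, hC⟩
    exact ⟨C, fun y hy => hC y ⟨hst hy.1, hy.2⟩⟩
  · rintro s t ⟨C, hC⟩ ⟨C', hC'⟩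
    refine ⟨max C C', fun y hy => ?_⟩
    rcases hy.1 with h | h
    · exact (hC y ⟨h, hy.2⟩).trans (le_max_left _ _)
    · exact (hC' y ⟨h, hy.2⟩).trans (le_max_right _ _)
  · intro x hx
    have h1 : ContDiffWithinAt ℝ (0 + 1) φ (closure D) x := by simpa using hφ x hx
    obtain ⟨u, hu, -, f', hf', hf'c⟩ :=
      (contDiffWithinAt_succ_iff_hasFDerivWithinAt (by simp)).1 h1
    rw [insert_eq_of_mem hx] at hu
    have hxu : x ∈ u := mem_of_mem_nhdsWithin hx hu
    have hbd : ∀ᶠ y in 𝓝[u] x, ‖f' y‖ < ‖f' x‖ + 1 :=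
      hf'c.continuousWithinAt.norm.eventually (gt_mem_nhds (by linarith))
    have hbd' : ∀ᶠ y in 𝓝[closure D] x, y ∈ u ∧ ‖f' y‖ < ‖f' x‖ + 1 :=
      (Filter.inter_mem hu (nhdsWithin_le_iff.2 hu hbd))
    obtain ⟨o, ho, hxo, ho2⟩ := mem_nhdsWithin.1 hbd'
    refine ⟨o ∩ closure D, Filter.inter_mem (mem_nhdsWithin_of_mem_nhds (ho.mem_nhds hxo))
      self_mem_nhdsWithin, ‖f' x‖ + 1, ?_⟩
    rintro y ⟨⟨hyo, hyc⟩, hyD⟩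
    have h2 := ho2 ⟨hyo, hyc⟩
    have hmem : u ∈ 𝓝 y := mem_of_superset ((ho.inter hD).mem_nhds ⟨hyo, hyD⟩)
      fun z hz => (ho2 ⟨hz.1, subset_closure hz.2⟩).1
    rw [((hf' y h2.1).hasFDerivAt hmem).fderiv]
    exact h2.2.le

theorem integrableOn_fderiv_of_contDiffOn_closure [FiniteDimensional ℝ E] [MeasurableSpace E]
    [BorelSpace E] {μ : Measure E} [IsFiniteMeasureOnCompacts μ] (hD : IsOpen D)
    (hb : Bornology.IsBounded D) (hφ : ContDiffOn ℝ 1 φ (closure D)) (e : E) :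
    IntegrableOn (fun y => fderiv ℝ φ y e) D μ := by
  have : ProperSpace E := FiniteDimensional.proper ℝ E
  obtain ⟨C, hC⟩ := exists_norm_fderiv_le hD hb hφ
  have hfin : μ D < ⊤ := (measure_mono subset_closure).trans_lt hb.isCompact_closure.measure_lt_top
  have : IsFiniteMeasure (μ.restrict D) := ⟨by rwa [Measure.restrict_apply_univ]⟩
  have hcont : ContinuousOn (fun y => fderiv ℝ φ y e) D :=
    ((hφ.mono subset_closure).continuousOn_fderiv_of_isOpen hD le_rfl).clm_apply
      continuousOn_const
  refine Integrable.of_bound (hcont.aestronglyMeasurable hD.measurableSet) (C * ‖e‖) ?_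
  refine (ae_restrict_mem hD.measurableSet).mono fun y hy => ?_
  exact ((fderiv ℝ φ y).le_opNorm e).trans (by gcongr; exact hC y hy)

theorem integral_fderiv_eq_zero_of_tsupport_subset [FiniteDimensional ℝ E] [MeasurableSpace E]
    [BorelSpace E] {μ : Measure E} [μ.IsAddHaarMeasure] (hD : IsOpen D)
    (hb : Bornology.IsBounded D) (hφ : ContDiffOn ℝ 1 φ (closure D)) (hs : tsupport φ ⊆ D) (e : E) :
    ∫ y in D, fderiv ℝ φ y e ∂μ = 0 := by
  have : ProperSpace E := FiniteDimensional.proper ℝ E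
  have hdiff : Differentiable ℝ φ := by
    intro y
    by_cases hy : y ∈ tsupport φ
    · exact ((hφ.mono subset_closure).differentiableOn one_ne_zero).differentiableAt
        (hD.mem_nhds (hs hy))
    · exact (differentiableAt_of_notMem_tsupport hy).1
  have h0 : ∀ y, y ∉ D → fderiv ℝ φ y e = 0 := fun y hy => by
    rw [(differentiableAt_of_notMem_tsupport fun h => hy (hs h)).2]; simp
  have hcs : HasCompactSupport φ :=
    (hb.isCompact_closure).of_isClosed_subset (isClosed_tsupport φ) (hs.trans subset_closure)
  have hint : Integrable (fun y => fderiv ℝ φ y e) μ := by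
    rw [← integrableOn_iff_integrable_of_support_subset (s := D) fun y hy => by
      by_contra h; exact hy (h0 y h)]
    exact integrableOn_fderiv_of_contDiffOn_closure hD hb hφ e
  rw [setIntegral_eq_integral_of_forall_compl_eq_zero h0]
  have h1 := integral_smul_fderiv_eq_neg_fderiv_smul_of_integrable (μ := μ)
    (f := fun _ : E => (1 : ℝ)) (g := φ) (v := e) (by simp) (by simpa using hint)
    (by simpa using hdiff.continuous.integrable_of_hasCompactSupport hcs)
    (fun x _ => differentiableAt_const _) (fun x _ => hdiff x)
  simpa using h1

end ContDiffOnClosure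

/-! ### The divergence theorem on smooth bounded domains -/

section Divergence

variable {n : ℕ} {D : Set (EuclideanSpace ℝ (Fin n))}

/-- Strict differentiability at `p` controls differences of values at two nearby points, which is
the Lipschitz form of flatness; dividing by the length of the gradient normalizes `ν`. -/
theorem IsDefiningFunctionAt.exists_isFlat (hD : IsOpen D) {p : EuclideanSpace ℝ (Fin n)}
    {ρ : EuclideanSpace ℝ (Fin n) → ℝ} (h : IsDefiningFunctionAt D p ρ) {δ : ℝ} (hδ : 0 < δ) :
    ∃ r > 0, IsFlat D (fun y => ‖gradient ρ p‖⁻¹ * ρ y) p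
      (‖gradient ρ p‖⁻¹ • gradient ρ p) r δ := by
  set m := ‖gradient ρ p‖ with hm
  have hm0 : 0 < m := norm_pos_iff.2 h.gradient_ne_zero
  have hstrict : HasStrictFDerivAt ρ (fderiv ℝ ρ p) p :=
    h.contDiff.contDiffAt.hasStrictFDerivAt (by simp)
  have hlit := hstrict.isLittleO.bound (mul_pos hδ hm0)
  rw [nhds_prod_eq] at hlit
  obtain ⟨pa, hpa, pb, hpb, hab⟩ := Filter.eventually_prod_iff.1 hlit
  obtain ⟨r, hr, hball⟩ := Metric.mem_nhds_iff.1 ((hpa.and hpb).and h.mem_iff)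
  refine ⟨r, hr, hD, ?_, ?_, ?_⟩
  · rw [norm_smul, norm_inv, norm_norm, inv_mul_cancel₀ hm0.ne']
  · intro y hy
    rw [(hball hy).2]
    constructor
    · intro h1; exact mul_neg_of_pos_of_neg (by positivity) h1
    · intro h1; by_contra h2; exact absurd h1 (not_lt.2 (mul_nonneg (by positivity) (not_lt.1 h2)))
  · intro y hy z hz
    have h1 := hab (hball hy).1.1 (hball hz).1.2
    simp only [Real.norm_eq_abs] at h1
    rw [inner_smul_left, inner_gradient_left]
    simp only [conj_trivial]
    rw [← mul_sub, ← mul_sub, abs_mul, abs_of_pos (by positivity)]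
    rw [inv_mul_le_iff₀ hm0]
    linarith

theorem IsSmoothBoundedDomain.exists_isFlat (hD : IsSmoothBoundedDomain D)
    {p : EuclideanSpace ℝ (Fin n)} (hp : p ∈ frontier D) {δ : ℝ} (hδ : 0 < δ) :
    ∃ r > 0, ∃ ρ, IsFlat D ρ p (outwardNormal D p) r δ := by
  have h := hD.smooth_boundary p hp
  obtain ⟨r, hr, hflat⟩ := h.choose_spec.exists_isFlat hD.isOpen hδ
  rw [outwardNormal, dif_pos h]
  exact ⟨r, hr, _, hflat⟩

/-- The defining function is chosen afresh at each point, so continuity does not come from that of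
one gradient; it comes from `norm_normal_sub_le`, which compares unrelated defining functions. -/
theorem IsSmoothBoundedDomain.continuousOn_outwardNormal (hD : IsSmoothBoundedDomain D) :
    ContinuousOn (outwardNormal D) (frontier D) := by
  intro p hp
  refine Metric.tendsto_nhds.2 fun ε hε => ?_
  set δ := min (1 / 4) (ε / 4)
  have hδ : 0 < δ := by positivity
  have hδ1 : δ ≤ 1 / 4 := min_le_left _ _
  have hδ2 : δ ≤ ε / 4 := min_le_right _ _
  obtain ⟨r, hr, ρ, h⟩ := hD.exists_isFlat hp hδ
  filter_upwards [mem_nhdsWithin_of_mem_nhds (Metric.ball_mem_nhds p hr), self_mem_nhdsWithin]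
    with q hq hq'
  obtain ⟨r', hr', ρ', h'⟩ := hD.exists_isFlat hq' hδ
  rw [dist_eq_norm]
  linarith [h.norm_normal_sub_le h' hδ.le hδ1 hr' ⟨hq', hq⟩]

theorem IsSmoothBoundedDomain.isCompact_frontier (hD : IsSmoothBoundedDomain D) :
    IsCompact (frontier D) :=
  hD.isBounded.isCompact_closure.of_isClosed_subset isClosed_frontier frontier_subset_closure

theorem IsSmoothBoundedDomain.measure_frontier_lt_top (hD : IsSmoothBoundedDomain D) {d : ℕ}
    (hn : n = d + 1) :
    μHE[d] (frontier D) < ⊤ := by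
  refine hD.isCompact_frontier.measure_lt_top_of_nhdsWithin fun p hp => ?_
  obtain ⟨r, hr, ρ, h⟩ := hD.exists_isFlat hp (show (0 : ℝ) < 1 / 4 by norm_num)
  exact ⟨frontier D ∩ Metric.ball p r, Filter.inter_mem self_mem_nhdsWithin
    (mem_nhdsWithin_of_mem_nhds (Metric.ball_mem_nhds p hr)),
    h.euclideanHausdorffMeasure_lt_top (by norm_num) le_rfl (by simp [hn])⟩

end Divergence

section Divergence

variable {n : ℕ} {D : Set (EuclideanSpace ℝ (Fin n))} {A : Type*} [NormedAddCommGroup A]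
  [NormedSpace ℝ A]

theorem IsSmoothBoundedDomain.integrableOn_frontier {A : Type*} [NormedAddCommGroup A]
    (hD : IsSmoothBoundedDomain D) {d : ℕ} (hn : n = d + 1)
    {φ : EuclideanSpace ℝ (Fin n) → A} (hφ : ContinuousOn φ (frontier D)) :
    IntegrableOn φ (frontier D) μHE[d] := by
  have : IsFiniteMeasure (μHE[d].restrict (frontier D)) :=
    ⟨by rw [Measure.restrict_apply_univ]; exact hD.measure_frontier_lt_top hn⟩
  obtain ⟨C, hC⟩ := hD.isCompact_frontier.exists_bound_of_continuousOn hφ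
  exact Integrable.of_bound (hφ.aestronglyMeasurable isClosed_frontier.measurableSet) C
    ((ae_restrict_mem isClosed_frontier.measurableSet).mono hC)

theorem IsSmoothBoundedDomain.continuousOn_inner_normal_smul (hD : IsSmoothBoundedDomain D)
    {φ : EuclideanSpace ℝ (Fin n) → A} (hφ : ContinuousOn φ (frontier D))
    (e : EuclideanSpace ℝ (Fin n)) :
    ContinuousOn (fun y => ⟪outwardNormal D y, e⟫ • φ y) (frontier D) :=
  (hD.continuousOn_outwardNormal.inner continuousOn_const).smul hφ

/-- The defect in the divergence theorem for `φ` in the direction `e`. -/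
noncomputable def divergenceDefect (D : Set (EuclideanSpace ℝ (Fin n))) (d : ℕ)
    (e : EuclideanSpace ℝ (Fin n)) (φ : EuclideanSpace ℝ (Fin n) → A) : A :=
  (∫ y in D, fderiv ℝ φ y e) - ∫ y in frontier D, ⟪outwardNormal D y, e⟫ • φ y ∂μHE[d]

theorem IsSmoothBoundedDomain.divergenceDefect_sum (hD : IsSmoothBoundedDomain D) {d : ℕ}
    (hn : n = d + 1) (e : EuclideanSpace ℝ (Fin n)) {ι : Type*} [Fintype ι]
    {φ : EuclideanSpace ℝ (Fin n) → A} {ψ : ι → EuclideanSpace ℝ (Fin n) → A}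
    (hψ : ∀ i, ContDiffOn ℝ 1 (ψ i) (closure D)) (h : ∀ y ∈ closure D, φ y = ∑ i, ψ i y) :
    divergenceDefect D d e φ = ∑ i, divergenceDefect D d e (ψ i) := by
  have h1 : ∫ y in D, fderiv ℝ φ y e = ∑ i, ∫ y in D, fderiv ℝ (ψ i) y e := by
    rw [← integral_finsetSum _ fun i _ =>
      integrableOn_fderiv_of_contDiffOn_closure hD.isOpen hD.isBounded (hψ i) e]
    refine setIntegral_congr_fun hD.isOpen.measurableSet fun y hy => ?_
    have heq : φ =ᶠ[𝓝 y] fun z => ∑ i, ψ i z :=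
      Filter.mem_of_superset (hD.isOpen.mem_nhds hy) fun z hz => h z (subset_closure hz)
    change fderiv ℝ φ y e = ∑ i, fderiv ℝ (ψ i) y e
    rw [heq.fderiv_eq, fderiv_fun_sum fun i _ =>
      (((hψ i).mono subset_closure).differentiableOn one_ne_zero).differentiableAt
        (hD.isOpen.mem_nhds hy)]
    simp
  have h2 : ∫ y in frontier D, ⟪outwardNormal D y, e⟫ • φ y ∂μHE[d] =
      ∑ i, ∫ y in frontier D, ⟪outwardNormal D y, e⟫ • ψ i y ∂μHE[d] := by
    rw [← integral_finsetSum _ fun i _ => hD.integrableOn_frontier hn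
      (hD.continuousOn_inner_normal_smul ((hψ i).continuousOn.mono frontier_subset_closure) e)]
    refine setIntegral_congr_fun isClosed_frontier.measurableSet fun y hy => ?_
    rw [h y (frontier_subset_closure hy), Finset.smul_sum]
  simp only [divergenceDefect, h1, h2, Finset.sum_sub_distrib]

variable [CompleteSpace A]

theorem IsSmoothBoundedDomain.exists_norm_divergenceDefect_le_of_mem_frontier
    (hD : IsSmoothBoundedDomain D) {d : ℕ} (hn : n = d + 1) {e : EuclideanSpace ℝ (Fin n)}
    (he : ‖e‖ ≤ 1) {p : EuclideanSpace ℝ (Fin n)} (hp : p ∈ frontier D) {ε : ℝ} (hε : 0 < ε) :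
    ∃ r > 0, ∀ φ : EuclideanSpace ℝ (Fin n) → A, ContDiffOn ℝ 1 φ (closure D) →
      tsupport φ ⊆ Metric.ball p r →
        ‖divergenceDefect D d e φ‖ ≤ ε * ∫ y in frontier D, ‖φ y‖ ∂μHE[d] := by
  have hdim : finrank ℝ (EuclideanSpace ℝ (Fin n)) = d + 1 := by simp [hn]
  -- The shares `ε/20` and `ε/10` are fixed by the final sum: `2·3·ε/10 + 3·ε/10 + 2·ε/20 = ε`.
  obtain ⟨δ, hδ0, hδ, hδε, hδε'⟩ : ∃ δ : ℝ, 0 < δ ∧ δ ≤ 1 / 4 ∧ δ ≤ ε / 20 ∧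
      (1 + 4 * δ) ^ d ≤ 1 + ε / 10 := by
    have hcont : Tendsto (fun δ : ℝ => (1 + 4 * δ) ^ d) (𝓝[>] 0) (𝓝 1) := by
      have : Tendsto (fun δ : ℝ => (1 + 4 * δ) ^ d) (𝓝 0) (𝓝 ((1 + 4 * 0) ^ d)) :=
        Continuous.tendsto (by fun_prop) 0
      rw [mul_zero, add_zero, one_pow] at this
      exact this.mono_left nhdsWithin_le_nhds
    have hsmall : ∀ c : ℝ, 0 < c → ∀ᶠ δ : ℝ in 𝓝[>] 0, δ ≤ c := fun c hc =>
      nhdsWithin_le_nhds (Iic_mem_nhds hc)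
    obtain ⟨δ, ⟨⟨h1, h2⟩, h3⟩, h4⟩ := ((((hsmall (1 / 4) (by norm_num)).and
      (hsmall (ε / 20) (by positivity))).and (hcont.eventually_le_const
        (show (1 : ℝ) < 1 + ε / 10 by linarith))).and self_mem_nhdsWithin).exists
    exact ⟨δ, h4, h1, h2, h3⟩
  obtain ⟨r, hr, ρ, H⟩ := hD.exists_isFlat hp hδ0
  set ν := outwardNormal D p with hν
  refine ⟨r, hr, fun φ hφ hs => ?_⟩
  have hνν : ⟪ν, ν⟫ = 1 := by rw [real_inner_self_eq_norm_sq, H.norm_eq]; norm_num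
  set a := ⟪ν, e⟫ with ha
  have ha1 : |a| ≤ 1 := by
    have := abs_real_inner_le_norm ν e
    rw [H.norm_eq, one_mul] at this
    exact this.trans he
  -- The direction `e` may be tangent to the boundary, so it is written as `(a - 1) ν + τ` with both
  -- `ν` and `τ` transversal. The tangential part of `e` has norm at most `1`, whence `‖τ‖ ≤ 2`.
  set τ := ν + (e - a • ν) with hτ
  have hντ : ⟪ν, τ⟫ = 1 := by
    rw [hτ, inner_add_right, inner_sub_right, inner_smul_right, hνν, ← ha]; ring
  have hτ2 : ‖τ‖ ≤ 2 := by
    have h1 : ‖e - a • ν‖ ^ 2 ≤ 1 := by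
      rw [norm_sub_sq_real, inner_smul_right, norm_smul, H.norm_eq, real_inner_comm, ← ha,
        Real.norm_eq_abs, mul_one, sq_abs]
      nlinarith [norm_nonneg e, sq_nonneg a]
    have h2 : ‖e - a • ν‖ ≤ 1 := by nlinarith [norm_nonneg (e - a • ν)]
    calc ‖τ‖ ≤ ‖ν‖ + ‖e - a • ν‖ := norm_add_le _ _
      _ ≤ 2 := by rw [H.norm_eq]; linarith
  have hcφ : ContinuousOn φ (closure D) := hφ.continuousOn
  have hdφ : DifferentiableOn ℝ φ D := (hφ.mono subset_closure).differentiableOn one_ne_zero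
  have hintD : ∀ v, IntegrableOn (fun y => fderiv ℝ φ y v) D := fun v =>
    integrableOn_fderiv_of_contDiffOn_closure hD.isOpen hD.isBounded hφ v
  have hcf : ContinuousOn φ (frontier D) := hcφ.mono frontier_subset_closure
  have hintF : IntegrableOn φ (frontier D) μHE[d] := hD.integrableOn_frontier hn hcf
  have hintN : IntegrableOn (fun y => ⟪outwardNormal D y, e⟫ • φ y) (frontier D) μHE[d] :=
    hD.integrableOn_frontier hn (hD.continuousOn_inner_normal_smul hcf e)
  set N := ∫ y in frontier D, ‖φ y‖ ∂μHE[d] with hN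
  have hN0 : 0 ≤ N := integral_nonneg fun y => norm_nonneg _
  have e1 := H.norm_integral_fderiv_sub_le hδ0.le hδ hνν (by rw [H.norm_eq]; norm_num) hdim
    (by positivity) hδε' hcφ hdφ hs (hintD ν) hintF
  have e2 := H.norm_integral_fderiv_sub_le hδ0.le hδ hντ hτ2 hdim
    (by positivity) hδε' hcφ hdφ hs (hintD τ) hintF
  rw [← hN] at e1 e2
  have e3 : ‖a • (∫ y in frontier D, φ y ∂μHE[d]) -
      ∫ y in frontier D, ⟪outwardNormal D y, e⟫ • φ y ∂μHE[d]‖ ≤ 2 * δ * N := by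
    rw [← integral_smul, ← integral_sub (f := fun y => a • φ y) (hintF.smul a) hintN, hN,
      ← integral_const_mul]
    refine norm_integral_le_of_norm_le (hintF.norm.const_mul _) ?_
    refine (ae_restrict_mem isClosed_frontier.measurableSet).mono fun y hy => ?_
    rw [← sub_smul, norm_smul]
    by_cases hyb : y ∈ Metric.ball p r
    · gcongr
      obtain ⟨r', hr', ρ', H'⟩ := hD.exists_isFlat hy hδ0
      have h1 := H.norm_normal_sub_le H' hδ0.le hδ hr' ⟨hy, hyb⟩
      rw [ha, ← inner_sub_left, Real.norm_eq_abs]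
      refine (abs_real_inner_le_norm _ _).trans ?_
      rw [norm_sub_rev]
      calc _ ≤ (2 * δ) * 1 := by gcongr
        _ = _ := mul_one _
    · rw [image_eq_zero_of_notMem_tsupport fun h => hyb (hs h)]; simp
  have e4 : ∫ y in D, fderiv ℝ φ y e =
      (a - 1) • (∫ y in D, fderiv ℝ φ y ν) + ∫ y in D, fderiv ℝ φ y τ := by
    rw [← integral_smul, ← integral_add (f := fun y => (a - 1) • fderiv ℝ φ y ν)
      ((hintD ν).smul (a - 1)) (hintD τ)]
    refine integral_congr_ae (Eventually.of_forall fun y => ?_)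
    simp only [← map_smul, ← map_add]
    congr 1
    rw [hτ, sub_smul, one_smul]; abel
  have e5 : divergenceDefect D d e φ =
      (a - 1) • ((∫ y in D, fderiv ℝ φ y ν) - ∫ y in frontier D, φ y ∂μHE[d]) +
      ((∫ y in D, fderiv ℝ φ y τ) - ∫ y in frontier D, φ y ∂μHE[d]) +
      (a • (∫ y in frontier D, φ y ∂μHE[d]) -
        ∫ y in frontier D, ⟪outwardNormal D y, e⟫ • φ y ∂μHE[d]) := by
    rw [divergenceDefect, e4, smul_sub, sub_smul _ _ (∫ y in frontier D, φ y ∂μHE[d]), one_smul]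
    abel
  have ha2 : |a - 1| ≤ 2 := by rw [abs_le] at *; constructor <;> linarith
  rw [e5]
  calc _ ≤ |a - 1| * ‖(∫ y in D, fderiv ℝ φ y ν) - ∫ y in frontier D, φ y ∂μHE[d]‖ +
      ‖(∫ y in D, fderiv ℝ φ y τ) - ∫ y in frontier D, φ y ∂μHE[d]‖ +
      ‖a • (∫ y in frontier D, φ y ∂μHE[d]) -
        ∫ y in frontier D, ⟪outwardNormal D y, e⟫ • φ y ∂μHE[d]‖ := by
        refine (norm_add₃_le).trans ?_
        rw [norm_smul, Real.norm_eq_abs]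
    _ ≤ 2 * (3 * (ε / 10) * N) + 3 * (ε / 10) * N + 2 * (ε / 20) * N := by
        gcongr
        exact e3.trans (by gcongr)
    _ = ε * N := by ring

theorem IsSmoothBoundedDomain.exists_norm_divergenceDefect_le
    (hD : IsSmoothBoundedDomain D) {d : ℕ} (hn : n = d + 1) {e : EuclideanSpace ℝ (Fin n)}
    (he : ‖e‖ ≤ 1) {p : EuclideanSpace ℝ (Fin n)} (hp : p ∈ closure D) {ε : ℝ} (hε : 0 < ε) :
    ∃ r > 0, ∀ φ : EuclideanSpace ℝ (Fin n) → A, ContDiffOn ℝ 1 φ (closure D) →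
      tsupport φ ⊆ Metric.ball p r →
        ‖divergenceDefect D d e φ‖ ≤ ε * ∫ y in frontier D, ‖φ y‖ ∂μHE[d] := by
  by_cases hpD : p ∈ D
  · obtain ⟨r, hr, hball⟩ := Metric.isOpen_iff.1 hD.isOpen p hpD
    refine ⟨r, hr, fun φ hφ hs => ?_⟩
    have h0 : ∀ y ∈ frontier D, φ y = 0 := fun y hy =>
      image_eq_zero_of_notMem_tsupport fun h =>
        (hD.isOpen.frontier_eq ▸ hy).2 (hball (hs h))
    rw [divergenceDefect, integral_fderiv_eq_zero_of_tsupport_subset hD.isOpen hD.isBounded hφ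
      (hs.trans hball), setIntegral_eq_zero_of_forall_eq_zero fun y hy => by rw [h0 y hy, smul_zero]]
    rw [sub_zero, norm_zero]
    exact mul_nonneg hε.le (integral_nonneg fun y => norm_nonneg _)
  · exact hD.exists_norm_divergenceDefect_le_of_mem_frontier hn he
      (hD.isOpen.frontier_eq ▸ ⟨hp, hpD⟩) hε

theorem IsSmoothBoundedDomain.norm_divergenceDefect_le (hD : IsSmoothBoundedDomain D) {d : ℕ}
    (hn : n = d + 1) {e : EuclideanSpace ℝ (Fin n)} (he : ‖e‖ ≤ 1)
    {φ : EuclideanSpace ℝ (Fin n) → A} (hφ : ContDiffOn ℝ 1 φ (closure D)) {ε : ℝ} (hε : 0 < ε) :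
    ‖divergenceDefect D d e φ‖ ≤ ε * ∫ y in frontier D, ‖φ y‖ ∂μHE[d] := by
  choose! r hr hloc using fun p (hp : p ∈ closure D) =>
    hD.exists_norm_divergenceDefect_le (A := A) hn he hp hε
  obtain ⟨t, ht⟩ := (hD.isBounded.isCompact_closure).elim_nhds_subcover'
    (fun p _ => Metric.ball p (r p)) fun p hp => Metric.ball_mem_nhds p (hr p hp)
  obtain ⟨f, hf⟩ := SmoothPartitionOfUnity.exists_isSubordinate (ι := t)
    𝓘(ℝ, EuclideanSpace ℝ (Fin n)) isClosed_closure
    (fun p => Metric.ball (p : EuclideanSpace ℝ (Fin n)) (r p)) (fun _ => Metric.isOpen_ball)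
    (by
      intro y hy
      obtain ⟨p, hp, hyp⟩ := mem_iUnion₂.1 (ht hy)
      exact mem_iUnion.2 ⟨⟨p, hp⟩, hyp⟩)
  have hsum1 : ∀ y ∈ closure D, ∑ i, f i y = 1 := fun y hy => by
    rw [← finsum_eq_sum_of_fintype]; exact f.sum_eq_one hy
  have hfc : ∀ i, ContDiffOn ℝ 1 (fun y => f i y • φ y) (closure D) := fun i =>
    (((f i).contMDiff.contDiff.of_le (by simp)).contDiffOn).smul hφ
  have hdecomp : ∀ y ∈ closure D, φ y = ∑ i, f i y • φ y := fun y hy => by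
    rw [← Finset.sum_smul, hsum1 y hy, one_smul]
  rw [hD.divergenceDefect_sum hn e hfc hdecomp]
  -- The weights are nonnegative with sum `1`, so the norms of the pieces add up exactly to the norm
  -- of `φ`, and the local errors sum to `ε N` however many pieces there are.
  have hnorm : ∫ y in frontier D, ‖φ y‖ ∂μHE[d] =
      ∑ i, ∫ y in frontier D, ‖f i y • φ y‖ ∂μHE[d] := by
    rw [← integral_finsetSum _ fun i _ => (hD.integrableOn_frontier hn
      ((hfc i).continuousOn.mono frontier_subset_closure)).norm]
    refine setIntegral_congr_fun isClosed_frontier.measurableSet fun y hy => ?_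
    simp only [norm_smul, Real.norm_of_nonneg (f.nonneg _ _)]
    rw [← Finset.sum_mul, hsum1 y (frontier_subset_closure hy), one_mul]
  rw [hnorm, Finset.mul_sum]
  refine norm_sum_le_of_le _ fun i _ => ?_
  exact hloc i i.1.2 _ (hfc i) ((tsupport_smul_subset_left _ _).trans (hf i))

/-- The **divergence theorem** on bounded domains with smooth boundary, for functions of class
`C¹` on the closure and with the Euclidean Hausdorff measure on the boundary. -/
theorem IsSmoothBoundedDomain.integral_fderiv_eq (hD : IsSmoothBoundedDomain D) {d : ℕ}
    (hn : n = d + 1) {e : EuclideanSpace ℝ (Fin n)} (he : ‖e‖ ≤ 1)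
    {φ : EuclideanSpace ℝ (Fin n) → A} (hφ : ContDiffOn ℝ 1 φ (closure D)) :
    ∫ y in D, fderiv ℝ φ y e =
      ∫ y in frontier D, ⟪outwardNormal D y, e⟫ • φ y ∂μHE[d] := by
  set N := ∫ y in frontier D, ‖φ y‖ ∂μHE[d] with hN
  have hN0 : 0 ≤ N := integral_nonneg fun y => norm_nonneg _
  have h : ‖divergenceDefect D d e φ‖ ≤ 0 := by
    refine le_of_forall_pos_le_add fun ε hε => ?_
    refine (hD.norm_divergenceDefect_le hn he hφ (show 0 < ε / (N + 1) by positivity)).trans ?_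
    rw [← hN, zero_add, div_mul_eq_mul_div, div_le_iff₀ (by positivity)]
    nlinarith
  exact sub_eq_zero.1 (norm_le_zero_iff.1 h)

end Divergence

/-! ### The radial cut-off profile and its divergence -/

section Profile

variable {n : ℕ}

/-- A smooth function which vanishes for `s ≤ 1` and equals `s ^ (-n / 2)` for `s ≥ 2`. -/
noncomputable def cutoffProfile (n : ℕ) (s : ℝ) : ℝ :=
  (1 - Real.smoothTransition (2 - s)) * s ^ (-(n : ℝ) / 2)

theorem cutoffProfile_of_le {s : ℝ} (hs : s ≤ 1) : cutoffProfile n s = 0 := by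
  rw [cutoffProfile, Real.smoothTransition.one_of_one_le (by linarith)]; ring

theorem cutoffProfile_of_ge {s : ℝ} (hs : 2 ≤ s) : cutoffProfile n s = s ^ (-(n : ℝ) / 2) := by
  rw [cutoffProfile, Real.smoothTransition.zero_of_nonpos (by linarith)]; ring

theorem cutoffProfile_sq {x : ℝ} (hx0 : 0 ≤ x) (hx : 2 ≤ x ^ 2) :
    cutoffProfile n (x ^ 2) = (x ^ n)⁻¹ := by
  rw [cutoffProfile_of_ge hx, ← Real.rpow_natCast, ← Real.rpow_mul hx0, ← Real.rpow_natCast,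
    ← Real.rpow_neg hx0]
  congr 1
  push_cast
  ring

theorem contDiff_cutoffProfile : ContDiff ℝ ∞ (cutoffProfile n) := by
  rw [contDiff_iff_contDiffAt]
  intro s
  rcases lt_or_ge s 1 with hs | hs
  · refine (contDiffAt_const (c := (0 : ℝ))).congr_of_eventuallyEq ?_
    filter_upwards [Iio_mem_nhds hs] with t ht using cutoffProfile_of_le (le_of_lt ht)
  · have hs0 : s ≠ 0 := by linarith
    have h1 : ContDiff ℝ ∞ fun t : ℝ => Real.smoothTransition (2 - t) :=
      Real.smoothTransition.contDiff.comp (contDiff_const.sub contDiff_id)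
    exact (contDiffAt_const.sub h1.contDiffAt).mul (Real.contDiffAt_rpow_const_of_ne hs0)

theorem hasDerivAt_cutoffProfile (s : ℝ) :
    HasDerivAt (cutoffProfile n) (deriv (cutoffProfile n) s) s :=
  (contDiff_cutoffProfile.differentiable (by simp) s).hasDerivAt

theorem continuous_deriv_cutoffProfile : Continuous (deriv (cutoffProfile n)) :=
  contDiff_cutoffProfile.continuous_deriv (by simp)

theorem deriv_cutoffProfile {s : ℝ} (hs : 0 < s) : deriv (cutoffProfile n) s =
    deriv Real.smoothTransition (2 - s) * s ^ (-(n : ℝ) / 2) +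
      (1 - Real.smoothTransition (2 - s)) * (-(n : ℝ) / 2 * s ^ (-(n : ℝ) / 2 - 1)) := by
  have h1 : HasDerivAt (fun t : ℝ => Real.smoothTransition (2 - t))
      (deriv Real.smoothTransition (2 - s) * (-1)) s := by
    refine HasDerivAt.comp s (h₂ := Real.smoothTransition) ?_ ((hasDerivAt_id s).const_sub 2)
    exact ((Real.smoothTransition.contDiff (n := 1)).differentiable one_ne_zero _).hasDerivAt
  have h2 : HasDerivAt (fun t : ℝ => t ^ (-(n : ℝ) / 2))
      (-(n : ℝ) / 2 * s ^ (-(n : ℝ) / 2 - 1)) s := Real.hasDerivAt_rpow_const (Or.inl hs.ne')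
  have h3 := (h1.const_sub 1).mul h2
  rw [mul_neg_one, neg_neg] at h3
  exact h3.deriv

/-- The divergence, at a point of square norm `s`, of the radial field with profile
`cutoffProfile n`. -/
noncomputable def radialDivergence (n : ℕ) (s : ℝ) : ℝ :=
  n * cutoffProfile n s + 2 * s * deriv (cutoffProfile n) s

theorem continuous_radialDivergence : Continuous (radialDivergence n) := by
  have h1 := (contDiff_cutoffProfile (n := n)).continuous
  have h2 := continuous_deriv_cutoffProfile (n := n)
  unfold radialDivergence
  fun_prop

/-- The power `s ^ (-n/2)` is the profile of a divergence-free field, so only the derivative of the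
cut-off survives. This gives both the sign and the support. -/
theorem radialDivergence_of_pos {s : ℝ} (hs : 0 < s) : radialDivergence n s =
    2 * s * deriv Real.smoothTransition (2 - s) * s ^ (-(n : ℝ) / 2) := by
  rw [radialDivergence, deriv_cutoffProfile hs, cutoffProfile, Real.rpow_sub_one hs.ne']
  field_simp
  ring

theorem radialDivergence_of_le {s : ℝ} (hs : s ≤ 0) : radialDivergence n s = 0 := by
  have h : deriv (cutoffProfile n) s = 0 := by
    have : cutoffProfile n =ᶠ[𝓝 s] fun _ => 0 := by
      filter_upwards [Iio_mem_nhds (show s < 1 by linarith)] with t ht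
        using cutoffProfile_of_le (le_of_lt ht)
    rw [this.deriv_eq, deriv_const]
  rw [radialDivergence, h, cutoffProfile_of_le (by linarith)]
  ring

theorem radialDivergence_of_ge {s : ℝ} (hs : 2 < s) : radialDivergence n s = 0 := by
  have h : deriv Real.smoothTransition (2 - s) = 0 := by
    have : Real.smoothTransition =ᶠ[𝓝 (2 - s)] fun _ => 0 := by
      filter_upwards [Iio_mem_nhds (show 2 - s < 0 by linarith)] with t ht
        using Real.smoothTransition.zero_of_nonpos (le_of_lt ht)
    rw [this.deriv_eq, deriv_const]
  rw [radialDivergence_of_pos (by linarith), h]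
  ring

theorem radialDivergence_nonneg (s : ℝ) : 0 ≤ radialDivergence n s := by
  rcases le_or_gt s 0 with hs | hs
  · rw [radialDivergence_of_le hs]
  · rw [radialDivergence_of_pos hs]
    have := Real.smoothTransition.monotone.deriv_nonneg (x := 2 - s)
    positivity

theorem exists_radialDivergence_ne_zero : ∃ s, 0 < s ∧ radialDivergence n s ≠ 0 := by
  have hdiff : Differentiable ℝ Real.smoothTransition :=
    (Real.smoothTransition.contDiff (n := 1)).differentiable one_ne_zero
  obtain ⟨t, ht, ht2⟩ := exists_deriv_eq_slope Real.smoothTransition (zero_lt_one (α := ℝ))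
    hdiff.continuous.continuousOn hdiff.differentiableOn
  have hs : 0 < 2 - t := by linarith [ht.2]
  refine ⟨2 - t, hs, ?_⟩
  rw [radialDivergence_of_pos hs, sub_sub_cancel, ht2, Real.smoothTransition.one,
    Real.smoothTransition.zero]
  have := Real.rpow_pos_of_pos hs (-(n : ℝ) / 2)
  norm_num
  exact ⟨hs.ne', this.ne'⟩

/-- The total mass of the divergence of the cut-off radial field. -/
noncomputable def radialMass (n : ℕ) : ℝ :=
  ∫ u : EuclideanSpace ℝ (Fin n), radialDivergence n (‖u‖ ^ 2)

theorem continuous_radialDivergence_norm :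
    Continuous fun u : EuclideanSpace ℝ (Fin n) => radialDivergence n (‖u‖ ^ 2) :=
  continuous_radialDivergence.comp (by fun_prop)

theorem radialDivergence_norm_eq_zero {u : EuclideanSpace ℝ (Fin n)} (hu : 2 ≤ ‖u‖) :
    radialDivergence n (‖u‖ ^ 2) = 0 :=
  radialDivergence_of_ge (by nlinarith)

theorem hasCompactSupport_radialDivergence_norm :
    HasCompactSupport fun u : EuclideanSpace ℝ (Fin n) => radialDivergence n (‖u‖ ^ 2) := by
  refine HasCompactSupport.intro (isCompact_closedBall (0 : EuclideanSpace ℝ (Fin n)) 2)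
    fun u hu => radialDivergence_norm_eq_zero ?_
  rw [mem_closedBall_zero_iff, not_le] at hu
  exact hu.le

/-- Positivity is all that is needed of this constant, because the coefficients `b` can be rescaled.
-/
theorem radialMass_pos (hn : n ≠ 0) : 0 < radialMass n := by
  obtain ⟨s, hs, hs0⟩ := exists_radialDivergence_ne_zero (n := n)
  refine continuous_radialDivergence_norm.integral_pos_of_hasCompactSupport_nonneg_nonzero
    hasCompactSupport_radialDivergence_norm (fun u => radialDivergence_nonneg _)
    (x := EuclideanSpace.single ⟨0, Nat.pos_of_ne_zero hn⟩ (√s)) ?_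
  simpa [abs_of_nonneg (Real.sqrt_nonneg s), Real.sq_sqrt hs.le] using hs0

end Profile

/-! ### The cut-off kernel and its flux -/

section Kernel

variable {A : Type*} [NormedRing A] [NormedAlgebra ℝ A] {n q : ℕ}

/-- The `j`-th component `∑ₘ a j m φₘ` of the numerator of the kernel. -/
noncomputable def kernelNumerator (a b : Matrix (Fin n) (Fin q) A) (j : Fin n) :
    EuclideanSpace ℝ (Fin n) →L[ℝ] A :=
  ∑ m, ∑ i, (EuclideanSpace.proj i : EuclideanSpace ℝ (Fin n) →L[ℝ] ℝ).smulRight (a j m * b i m)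

theorem kernelNumerator_sub (a b : Matrix (Fin n) (Fin q) A) (j : Fin n)
    (x y : EuclideanSpace ℝ (Fin n)) :
    kernelNumerator a b j (y - x) = ∑ m, a j m * linearPhi b m x y := by
  simp [kernelNumerator, linearPhi, Finset.mul_sum]

/-- The quadratic form `∑ⱼ yⱼ (∑ₘ a j m φₘ(y))`. -/
noncomputable def kernelForm (a b : Matrix (Fin n) (Fin q) A) (y : EuclideanSpace ℝ (Fin n)) : A :=
  ∑ j, y j • kernelNumerator a b j y

/-- The trace of the quadratic form `kernelForm a b`. -/
noncomputable def kernelTrace (a b : Matrix (Fin n) (Fin q) A) : A :=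
  ∑ j, kernelNumerator a b j (EuclideanSpace.single j 1)

/-- The divergence of the kernel after the singularity has been cut off. -/
noncomputable def kernelDivergence (a b : Matrix (Fin n) (Fin q) A)
    (u : EuclideanSpace ℝ (Fin n)) : A :=
  cutoffProfile n (‖u‖ ^ 2) • kernelTrace a b +
    (2 * deriv (cutoffProfile n) (‖u‖ ^ 2)) • kernelForm a b u

theorem continuous_kernelDivergence (a b : Matrix (Fin n) (Fin q) A) :
    Continuous (kernelDivergence a b) := by
  have h1 := (contDiff_cutoffProfile (n := n)).continuous
  have h2 := continuous_deriv_cutoffProfile (n := n)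
  unfold kernelDivergence kernelForm
  fun_prop

theorem kernelForm_smul (a b : Matrix (Fin n) (Fin q) A) (t : ℝ) (y : EuclideanSpace ℝ (Fin n)) :
    kernelForm a b (t • y) = t ^ 2 • kernelForm a b y := by
  simp only [kernelForm, map_smul, Finset.smul_sum, smul_smul, PiLp.smul_apply, smul_eq_mul]
  refine Finset.sum_congr rfl fun j _ => ?_
  congr 1
  ring

theorem kernelDensity_eq (a b : Matrix (Fin n) (Fin q) A) (D : Set (EuclideanSpace ℝ (Fin n)))
    (x y : EuclideanSpace ℝ (Fin n)) : kernelDensity a b D x y =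
      ∑ j, outwardNormal D y j • (‖y - x‖ ^ n)⁻¹ • kernelNumerator a b j (y - x) := by
  rw [kernelDensity, Finset.sum_comm]
  refine Finset.sum_congr rfl fun j _ => ?_
  rw [kernelNumerator_sub, smul_smul, Finset.smul_sum, div_eq_mul_inv]

/-- The `j`-th component of the kernel with its singularity cut off at scale `ε`. -/
noncomputable def cutoffKernel (a b : Matrix (Fin n) (Fin q) A) (ε : ℝ)
    (x : EuclideanSpace ℝ (Fin n)) (j : Fin n) (y : EuclideanSpace ℝ (Fin n)) : A :=
  ((ε ^ n)⁻¹ * cutoffProfile n (‖ε⁻¹ • (y - x)‖ ^ 2)) • kernelNumerator a b j (y - x)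

variable (a b : Matrix (Fin n) (Fin q) A) {ε : ℝ} (x : EuclideanSpace ℝ (Fin n))

theorem contDiff_cutoffKernel (j : Fin n) : ContDiff ℝ 1 (cutoffKernel a b ε x j) := by
  have h1 : ContDiff ℝ 1 (cutoffProfile n) := contDiff_cutoffProfile.of_le (by simp)
  have h2 : ContDiff ℝ 1 fun y : EuclideanSpace ℝ (Fin n) => ‖ε⁻¹ • (y - x)‖ ^ 2 :=
    (contDiff_norm_sq ℝ).comp ((contDiff_id.sub contDiff_const).const_smul ε⁻¹)
  have h3 : ContDiff ℝ 1 fun y : EuclideanSpace ℝ (Fin n) =>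
      cutoffProfile n (‖ε⁻¹ • (y - x)‖ ^ 2) := h1.comp h2
  have h4 : ContDiff ℝ 1 fun y : EuclideanSpace ℝ (Fin n) => kernelNumerator a b j (y - x) :=
    (kernelNumerator a b j).contDiff.comp (contDiff_id.sub contDiff_const)
  have h5 : ContDiff ℝ 1 fun y : EuclideanSpace ℝ (Fin n) =>
      (ε ^ n)⁻¹ * cutoffProfile n (‖ε⁻¹ • (y - x)‖ ^ 2) := contDiff_const.mul h3
  unfold cutoffKernel
  exact h5.smul h4

theorem cutoffKernel_of_le (hε : 0 < ε) (j : Fin n) {y : EuclideanSpace ℝ (Fin n)}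
    (hy : 2 * ε ^ 2 ≤ ‖y - x‖ ^ 2) :
    cutoffKernel a b ε x j y = (‖y - x‖ ^ n)⁻¹ • kernelNumerator a b j (y - x) := by
  have h1 : ‖ε⁻¹ • (y - x)‖ = ε⁻¹ * ‖y - x‖ := by
    rw [norm_smul, norm_inv, Real.norm_of_nonneg hε.le]
  rw [cutoffKernel, cutoffProfile_sq (norm_nonneg _), h1, mul_pow, mul_inv, inv_pow, inv_inv,
    ← mul_assoc, inv_mul_cancel₀ (by positivity), one_mul]
  rw [h1, mul_pow, inv_pow, le_inv_mul_iff₀ (by positivity)]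
  linarith

theorem fderiv_cutoffKernel (j : Fin n) (y v : EuclideanSpace ℝ (Fin n)) :
    fderiv ℝ (cutoffKernel a b ε x j) y v =
      (ε ^ n)⁻¹ • (cutoffProfile n (‖ε⁻¹ • (y - x)‖ ^ 2) • kernelNumerator a b j v +
        (deriv (cutoffProfile n) (‖ε⁻¹ • (y - x)‖ ^ 2) *
          (2 * ⟪ε⁻¹ • (y - x), v⟫)) • kernelNumerator a b j (ε⁻¹ • (y - x))) := by
  have h0 : HasFDerivAt (fun y : EuclideanSpace ℝ (Fin n) => y - x)
      (ContinuousLinearMap.id ℝ _) y := (hasFDerivAt_id y).sub_const x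
  have h1 := (h0.const_smul ε⁻¹).norm_sq
  have h2 := ((hasDerivAt_cutoffProfile (n := n) (‖ε⁻¹ • (y - x)‖ ^ 2)).comp_hasFDerivAt y h1)
  have h3 := ((h2.const_mul (ε ^ n)⁻¹).smul ((kernelNumerator a b j).hasFDerivAt.comp y h0))
  have h4 : HasFDerivAt (cutoffKernel a b ε x j) _ y := h3
  rw [h4.fderiv]
  simp only [add_apply, smul_apply, ContinuousLinearMap.smulRight_apply,
    ContinuousLinearMap.coe_comp, Function.comp_apply, innerSL_apply_apply,
    ContinuousLinearMap.coe_id', id_eq, map_smul, Pi.smul_apply, inner_smul_left, smul_add,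
    smul_smul, smul_eq_mul, conj_trivial, nsmul_eq_mul]
  congr 2
  push_cast
  ring

theorem sum_fderiv_cutoffKernel (y : EuclideanSpace ℝ (Fin n)) :
    ∑ j, fderiv ℝ (cutoffKernel a b ε x j) y (EuclideanSpace.single j 1) =
      (ε ^ n)⁻¹ • kernelDivergence a b (ε⁻¹ • (y - x)) := by
  simp only [fderiv_cutoffKernel, ← Finset.smul_sum, Finset.sum_add_distrib]
  rw [kernelDivergence, kernelTrace, kernelForm]
  congr 2
  rw [Finset.smul_sum]
  refine Finset.sum_congr rfl fun j _ => ?_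
  rw [EuclideanSpace.inner_single_right, smul_smul]
  congr 1
  simp
  ring

variable {a} {D : Set (EuclideanSpace ℝ (Fin n))} {f : EuclideanSpace ℝ (Fin n) → A}

/-- The `a j m` stand to the left of `φₘ`, so by associativity they meet the derivatives of `f`
first, and the sum over `j` for fixed `m` is the Cauchy condition. -/
theorem IsCauchyFunction.sum_fderiv_mul_cutoffKernel (hf : IsCauchyFunction a D f)
    {y : EuclideanSpace ℝ (Fin n)} (hy : y ∈ D) :
    ∑ j, fderiv ℝ f y (EuclideanSpace.single j 1) * cutoffKernel a b ε x j y = 0 := by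
  simp only [cutoffKernel, mul_smul_comm, ← Finset.smul_sum, kernelNumerator_sub, Finset.mul_sum]
  rw [Finset.sum_comm]
  simp only [← mul_assoc, ← Finset.sum_mul, hf.cauchy y hy, zero_mul, Finset.sum_const_zero,
    smul_zero]

theorem IsCauchyFunction.sum_fderiv_mul (hD : IsOpen D) (hf : IsCauchyFunction a D f)
    {y : EuclideanSpace ℝ (Fin n)} (hy : y ∈ D) :
    ∑ j, fderiv ℝ (fun z => f z * cutoffKernel a b ε x j z) y (EuclideanSpace.single j 1) =
      f y * ((ε ^ n)⁻¹ • kernelDivergence a b (ε⁻¹ • (y - x))) := by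
  have hfd : DifferentiableAt ℝ f y :=
    ((hf.contDiffOn.mono subset_closure).differentiableOn one_ne_zero).differentiableAt
      (hD.mem_nhds hy)
  have h1 : ∀ j, fderiv ℝ (fun z => f z * cutoffKernel a b ε x j z) y
      (EuclideanSpace.single j 1) =
      f y * fderiv ℝ (cutoffKernel a b ε x j) y (EuclideanSpace.single j 1) +
        fderiv ℝ f y (EuclideanSpace.single j 1) * cutoffKernel a b ε x j y := by
    intro j
    have h2 := hfd.hasFDerivAt.mul'
      ((contDiff_cutoffKernel a b (ε := ε) x j).differentiable one_ne_zero y).hasFDerivAt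
    have h3 : HasFDerivAt (fun z => f z * cutoffKernel a b ε x j z) _ y := h2
    rw [h3.fderiv]
    simp
  simp only [h1, Finset.sum_add_distrib]
  rw [hf.sum_fderiv_mul_cutoffKernel b x hy, add_zero, ← Finset.mul_sum,
    sum_fderiv_cutoffKernel]

variable [CompleteSpace A] {x}

/-- The divergence theorem is applied to `f` times the cut-off kernel. The boundary stays at
distance at least `√2 ε` from `x`, where the cut-off changes nothing, so the left-hand sides do not
depend on `ε`. -/
theorem IsCauchyFunction.boundary_integral_eq (hD : IsSmoothBoundedDomain D)
    (hf : IsCauchyFunction a D f) {d : ℕ} (hn : n = d + 1) (hε : 0 < ε)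
    (hx : ∀ y ∈ frontier D, 2 * ε ^ 2 ≤ ‖y - x‖ ^ 2) :
    IntegrableOn (fun y => f y * kernelDensity a b D x y) (frontier D) μHE[d] ∧
    ∫ y in frontier D, f y * kernelDensity a b D x y ∂μHE[d] =
      ∫ y in D, f y * ((ε ^ n)⁻¹ • kernelDivergence a b (ε⁻¹ • (y - x))) := by
  have hφ : ∀ j, ContDiffOn ℝ 1 (fun z => f z * cutoffKernel a b ε x j z) (closure D) := fun j =>
    hf.contDiffOn.mul (contDiff_cutoffKernel a b x j).contDiffOn
  have hker : ∀ y ∈ frontier D, f y * kernelDensity a b D x y =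
      ∑ j, ⟪outwardNormal D y, EuclideanSpace.single j 1⟫ •
        (f y * cutoffKernel a b ε x j y) := by
    intro y hy
    rw [kernelDensity_eq, Finset.mul_sum]
    refine Finset.sum_congr rfl fun j _ => ?_
    rw [cutoffKernel_of_le a b x hε j (hx y hy), EuclideanSpace.inner_single_right, mul_smul_comm]
    simp
  have hint : ∀ j, IntegrableOn (fun y => ⟪outwardNormal D y, EuclideanSpace.single j 1⟫ •
      (f y * cutoffKernel a b ε x j y)) (frontier D) μHE[d] := fun j =>
    hD.integrableOn_frontier hn (hD.continuousOn_inner_normal_smul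
      ((hφ j).continuousOn.mono frontier_subset_closure) _)
  constructor
  · refine (integrable_finsetSum Finset.univ fun j _ => hint j).congr ?_
    exact (ae_restrict_mem isClosed_frontier.measurableSet).mono fun y hy => by
      simpa using (hker y hy).symm
  · rw [setIntegral_congr_fun isClosed_frontier.measurableSet hker,
      integral_finsetSum _ fun j _ => hint j]
    rw [setIntegral_congr_fun hD.isOpen.measurableSet fun y hy =>
      (hf.sum_fderiv_mul b x (ε := ε) hD.isOpen hy).symm,
      integral_finsetSum _ fun j _ =>
        integrableOn_fderiv_of_contDiffOn_closure hD.isOpen hD.isBounded (hφ j) _]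
    refine Finset.sum_congr rfl fun j _ => ?_
    exact (hD.integral_fderiv_eq hn (by simp) (hφ j)).symm

end Kernel

/-! ### Radial quadratic forms reproduce Cauchy functions -/

section Reproducing

variable {A : Type*} [NormedRing A] [NormedAlgebra ℝ A] {n q : ℕ} {a b : Matrix (Fin n) (Fin q) A}
  {c : A}

theorem kernelTrace_eq_of_kernelForm (h : ∀ y, kernelForm a b y = ‖y‖ ^ 2 • c) :
    kernelTrace a b = (n : ℝ) • c := by
  have h1 : ∀ j, kernelNumerator a b j (EuclideanSpace.single j 1) = c := by
    intro j
    have h2 := h (EuclideanSpace.single j 1)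
    rw [kernelForm, Finset.sum_eq_single j (fun i _ hi => by simp [hi]) (by simp)] at h2
    simpa using h2
  simp only [kernelTrace, h1, Finset.sum_const, Finset.card_univ, Fintype.card_fin]
  exact (Nat.cast_smul_eq_nsmul ℝ n c).symm

theorem kernelDivergence_eq_of_kernelForm (h : ∀ y, kernelForm a b y = ‖y‖ ^ 2 • c)
    (u : EuclideanSpace ℝ (Fin n)) :
    kernelDivergence a b u = radialDivergence n (‖u‖ ^ 2) • c := by
  rw [kernelDivergence, kernelTrace_eq_of_kernelForm h, h, smul_smul, smul_smul, ← add_smul,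
    radialDivergence]
  congr 1
  ring

theorem integral_radialDivergence_smul {ε : ℝ} (hε : 0 < ε) (x : EuclideanSpace ℝ (Fin n)) :
    ∫ y : EuclideanSpace ℝ (Fin n), (ε ^ n)⁻¹ * radialDivergence n (‖ε⁻¹ • (y - x)‖ ^ 2) =
      radialMass n := by
  rw [integral_sub_right_eq_self
    (fun y : EuclideanSpace ℝ (Fin n) => (ε ^ n)⁻¹ * radialDivergence n (‖ε⁻¹ • y‖ ^ 2)) x,
    integral_const_mul, Measure.integral_comp_inv_smul volume
    (fun y : EuclideanSpace ℝ (Fin n) => radialDivergence n (‖y‖ ^ 2))]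
  rw [finrank_euclideanSpace_fin, abs_of_pos (by positivity), smul_eq_mul, ← mul_assoc,
    inv_mul_cancel₀ (by positivity), one_mul, radialMass]

theorem exists_pos_le_norm_sub_of_mem {D : Set (EuclideanSpace ℝ (Fin n))} (hD : IsOpen D)
    {x : EuclideanSpace ℝ (Fin n)} (hx : x ∈ D) : ∃ r : ℝ, 0 < r ∧ Metric.ball x r ⊆ D ∧
      ∀ ε : ℝ, 0 < ε → ε ≤ r / 2 → ∀ y ∈ frontier D, 2 * ε ^ 2 ≤ ‖y - x‖ ^ 2 := by
  obtain ⟨r, hr, hball⟩ := Metric.isOpen_iff.1 hD x hx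
  refine ⟨r, hr, hball, fun ε hε hεr y hy => ?_⟩
  have h1 : r ≤ ‖y - x‖ := by
    by_contra! h
    exact (hD.frontier_eq ▸ hy).2 (hball (by rwa [Metric.mem_ball, dist_eq_norm]))
  nlinarith

variable [CompleteSpace A] {D : Set (EuclideanSpace ℝ (Fin n))} {f : EuclideanSpace ℝ (Fin n) → A}
  {x : EuclideanSpace ℝ (Fin n)}

/-- Smeared point values of `f` with respect to the cut-off kernel tend to its value at `x`. -/
theorem exists_norm_integral_sub_le (hD : IsOpen D) (hx : x ∈ D) (hf : ContinuousOn f D)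
    (c : A) {η : ℝ} (hη : 0 < η) : ∃ r : ℝ, 0 < r ∧ ∀ ε : ℝ, 0 < ε → ε ≤ r →
      ‖(∫ y in D, f y * ((ε ^ n)⁻¹ • radialDivergence n (‖ε⁻¹ • (y - x)‖ ^ 2) • c)) -
        radialMass n • (f x * c)‖ ≤ η * ‖c‖ * radialMass n := by
  have hcont := hf.continuousAt (hD.mem_nhds hx)
  obtain ⟨r, hr, hball⟩ := Metric.mem_nhds_iff.1 ((hD.mem_nhds hx : D ∈ 𝓝 x) |>
    Filter.inter_mem (Metric.tendsto_nhds.1 hcont η hη))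
  refine ⟨r / 2, by positivity, fun ε hε hεr => ?_⟩
  set κ : EuclideanSpace ℝ (Fin n) → ℝ :=
    fun y => (ε ^ n)⁻¹ * radialDivergence n (‖ε⁻¹ • (y - x)‖ ^ 2) with hκ
  have hκ0 : ∀ y, 0 ≤ κ y := fun y => mul_nonneg (by positivity) (radialDivergence_nonneg _)
  have hκs : ∀ y, y ∉ Metric.ball x r → κ y = 0 := by
    intro y hy
    rw [Metric.mem_ball, dist_eq_norm, not_lt] at hy
    have : 2 ≤ ‖ε⁻¹ • (y - x)‖ := by
      rw [norm_smul, norm_inv, Real.norm_of_nonneg hε.le, le_inv_mul_iff₀ hε]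
      linarith
    simp only [hκ, radialDivergence_norm_eq_zero this, mul_zero]
  have hκc : Continuous κ := by
    have h1 : Continuous fun y : EuclideanSpace ℝ (Fin n) => ε⁻¹ • (y - x) := by fun_prop
    exact continuous_const.mul (continuous_radialDivergence_norm.comp h1)
  have hκi : Integrable κ := by
    refine hκc.integrable_of_hasCompactSupport (HasCompactSupport.intro
      (isCompact_closedBall x r) fun y hy => hκs y fun h => hy (Metric.ball_subset_closedBall h))
  have hκI : ∫ y, κ y = radialMass n := integral_radialDivergence_smul hε x
  set F : EuclideanSpace ℝ (Fin n) → A := fun y => κ y • (f y * c) with hF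
  have hFD : ∫ y in D, f y * ((ε ^ n)⁻¹ • radialDivergence n (‖ε⁻¹ • (y - x)‖ ^ 2) • c) =
      ∫ y in Metric.ball x r, F y := by
    rw [setIntegral_eq_of_subset_of_forall_sdiff_eq_zero (s := Metric.ball x r)
      hD.measurableSet (fun y hy => (hball hy).2)]
    · simp only [hF, hκ, smul_smul, mul_smul_comm]
    · intro y hy
      have := hκs y hy.2
      rw [smul_smul]
      change f y * (κ y • c) = 0
      rw [this, zero_smul, mul_zero]
  have hκB : ∫ y in Metric.ball x r, κ y = radialMass n := by
    rw [← hκI]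
    exact setIntegral_eq_integral_of_forall_compl_eq_zero hκs
  have hbd : ∀ y ∈ Metric.ball x r, ‖F y - κ y • (f x * c)‖ ≤ κ y * (η * ‖c‖) := by
    intro y hy
    rw [hF, ← smul_sub, ← sub_mul, norm_smul, Real.norm_of_nonneg (hκ0 y)]
    refine mul_le_mul_of_nonneg_left ((norm_mul_le _ _).trans ?_) (hκ0 y)
    gcongr
    rw [← dist_eq_norm]
    exact (hball hy).1.le
  have hκx : IntegrableOn (fun y => κ y • (f x * c)) (Metric.ball x r) :=
    (hκi.smul_const _).integrableOn
  have hFsub : IntegrableOn (fun y => F y - κ y • (f x * c)) (Metric.ball x r) := by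
    refine Integrable.mono' ((hκi.mul_const (η * ‖c‖)).integrableOn) ?_
      ((ae_restrict_mem measurableSet_ball).mono hbd)
    refine ContinuousOn.aestronglyMeasurable ?_ measurableSet_ball
    exact (hκc.continuousOn.smul ((hf.mono fun y hy => (hball hy).2).mul continuousOn_const)).sub
      (hκc.smul continuous_const).continuousOn
  have hFi : IntegrableOn F (Metric.ball x r) := by
    have := hFsub.add hκx
    refine this.congr (Eventually.of_forall fun y => ?_)
    simp
  rw [hFD, ← hκB, ← integral_smul_const, ← integral_sub hFi hκx, mul_comm,
    ← integral_mul_const]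
  exact norm_integral_le_of_norm_le ((hκi.mul_const (η * ‖c‖)).integrableOn)
    ((ae_restrict_mem measurableSet_ball).mono hbd)

/-- The boundary integral of a Cauchy function against a kernel with radial quadratic form. -/
theorem IsCauchyFunction.boundary_integral_eq_of_kernelForm (hD : IsSmoothBoundedDomain D)
    (hf : IsCauchyFunction a D f) {d : ℕ} (hn : n = d + 1)
    (h : ∀ y, kernelForm a b y = ‖y‖ ^ 2 • c) (hx : x ∈ D) :
    IntegrableOn (fun y => f y * kernelDensity a b D x y) (frontier D) μHE[d] ∧
    ∫ y in frontier D, f y * kernelDensity a b D x y ∂μHE[d] = radialMass n • (f x * c) := by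
  obtain ⟨r, hr, hball, hε⟩ := exists_pos_le_norm_sub_of_mem hD.isOpen hx
  refine ⟨(hf.boundary_integral_eq b hD hn (half_pos hr) (hε _ (half_pos hr) le_rfl)).1, ?_⟩
  have hm : 0 < radialMass n := radialMass_pos (by omega)
  rw [← sub_eq_zero, ← norm_le_zero_iff]
  -- The boundary integral does not involve the cut-off scale, so it suffices to bound the distance
  -- to the limit by every `η > 0`, with the scale chosen after `η`.
  refine le_of_forall_pos_le_add fun η hη => ?_
  set η' := η / (‖c‖ * radialMass n + 1) with hη'
  have hη0 : 0 < η' := by positivity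
  obtain ⟨r', hr', hlim⟩ := exists_norm_integral_sub_le hD.isOpen hx
    (hf.contDiffOn.continuousOn.mono subset_closure) c hη0
  have hmin : 0 < min (r / 2) r' := by positivity
  have h1 := hlim _ hmin (min_le_right _ _)
  rw [(hf.boundary_integral_eq b hD hn hmin (hε _ hmin (min_le_left _ _))).2]
  simp only [kernelDivergence_eq_of_kernelForm h]
  refine h1.trans ?_
  rw [zero_add, mul_assoc, hη', div_mul_eq_mul_div, div_le_iff₀ (by positivity)]
  nlinarith

end Reproducing

/-! ### Balls and annuli as test domains -/

section Domains

variable {n : ℕ}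

theorem isDefiningFunctionAt_outer {D : Set (EuclideanSpace ℝ (Fin n))}
    {p y : EuclideanSpace ℝ (Fin n)} {R : ℝ} (hR : 0 < R) (hy : ‖y - p‖ = R)
    (hD : ∀ᶠ z in 𝓝 y, (z ∈ D ↔ ‖z - p‖ < R)) :
    IsDefiningFunctionAt D y fun z => ‖z - p‖ ^ 2 - R ^ 2 := by
  have hgrad : HasGradientAt (fun z => ‖z - p‖ ^ 2 - R ^ 2) ((2 : ℝ) • (y - p)) y := by
    rw [hasGradientAt_iff_hasFDerivAt]
    have h1 := (((hasFDerivAt_id (𝕜 := ℝ) y).sub_const p).norm_sq).sub_const (R ^ 2)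
    refine h1.congr_fderiv ?_
    ext v
    simp
  refine ⟨?_, ?_, ?_⟩
  · exact ((contDiff_norm_sq ℝ).comp (contDiff_id.sub contDiff_const)).sub contDiff_const
  · rw [hgrad.gradient, ← norm_ne_zero_iff, norm_smul, hy]
    norm_num
    exact hR.ne'
  · filter_upwards [hD] with z hz
    rw [hz, sub_neg, sq_lt_sq₀ (norm_nonneg _) hR.le]

theorem isDefiningFunctionAt_inner {D : Set (EuclideanSpace ℝ (Fin n))}
    {p y : EuclideanSpace ℝ (Fin n)} {R : ℝ} (hR : 0 < R) (hy : ‖y - p‖ = R)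
    (hD : ∀ᶠ z in 𝓝 y, (z ∈ D ↔ R < ‖z - p‖)) :
    IsDefiningFunctionAt D y fun z => R ^ 2 - ‖z - p‖ ^ 2 := by
  have hgrad : HasGradientAt (fun z => R ^ 2 - ‖z - p‖ ^ 2) ((-2 : ℝ) • (y - p)) y := by
    rw [hasGradientAt_iff_hasFDerivAt]
    have h1 := (((hasFDerivAt_id (𝕜 := ℝ) y).sub_const p).norm_sq).const_sub (R ^ 2)
    refine h1.congr_fderiv ?_
    ext v
    simp
  refine ⟨?_, ?_, ?_⟩
  · exact contDiff_const.sub ((contDiff_norm_sq ℝ).comp (contDiff_id.sub contDiff_const))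
  · rw [hgrad.gradient, ← norm_ne_zero_iff, norm_smul, hy]
    norm_num
    exact hR.ne'
  · filter_upwards [hD] with z hz
    rw [hz, sub_neg, sq_lt_sq₀ hR.le (norm_nonneg _)]

theorem isSmoothBoundedDomain_ball (p : EuclideanSpace ℝ (Fin n)) {R : ℝ} (hR : 0 < R) :
    IsSmoothBoundedDomain (Metric.ball p R) where
  isOpen := Metric.isOpen_ball
  isConnected := ⟨⟨p, Metric.mem_ball_self hR⟩, (convex_ball p R).isPreconnected⟩
  isBounded := Metric.isBounded_ball
  smooth_boundary := fun y hy => ⟨_, isDefiningFunctionAt_outer hR (p := p) (R := R)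
    (by simpa [frontier_ball p hR.ne', dist_eq_norm] using hy)
    (Eventually.of_forall fun z => by rw [Metric.mem_ball, dist_eq_norm])⟩

theorem isConnected_annulus (hn : 1 < n) (p : EuclideanSpace ℝ (Fin n)) {δ R : ℝ} (hδ : 0 < δ)
    (hR : δ < R) : IsConnected {y | δ < ‖y - p‖ ∧ ‖y - p‖ < R} := by
  have hrank : 1 < Module.rank ℝ (EuclideanSpace ℝ (Fin n)) := by
    rw [← finrank_eq_rank, finrank_euclideanSpace_fin]
    exact_mod_cast hn
  have h1 : IsConnected (Metric.sphere (0 : EuclideanSpace ℝ (Fin n)) 1 ×ˢ Ioo δ R) :=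
    (isConnected_sphere hrank 0 zero_le_one).prod (isConnected_Ioo hR)
  have h2 := h1.image (fun x => p + x.2 • x.1) (by fun_prop)
  convert h2 using 1
  ext y
  constructor
  · rintro ⟨hy1, hy2⟩
    have h0 : ‖y - p‖ ≠ 0 := by linarith
    refine ⟨(‖y - p‖⁻¹ • (y - p), ‖y - p‖), ⟨?_, hy1, hy2⟩, ?_⟩
    · rw [mem_sphere_zero_iff_norm, norm_smul, norm_inv, norm_norm, inv_mul_cancel₀ h0]
    · simp [smul_smul, mul_inv_cancel₀ h0]
  · rintro ⟨⟨θ, t⟩, ⟨hθ, ht⟩, rfl⟩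
    rw [mem_sphere_zero_iff_norm] at hθ
    have : ‖p + t • θ - p‖ = t := by
      rw [add_sub_cancel_left, norm_smul, hθ, mul_one, Real.norm_of_nonneg (hδ.trans ht.1).le]
    change δ < ‖p + t • θ - p‖ ∧ ‖p + t • θ - p‖ < R
    rw [this]
    exact ht

theorem isOpen_annulus (p : EuclideanSpace ℝ (Fin n)) (δ R : ℝ) :
    IsOpen {y | δ < ‖y - p‖ ∧ ‖y - p‖ < R} := by
  have hcont : Continuous fun z : EuclideanSpace ℝ (Fin n) => ‖z - p‖ := by fun_prop
  exact (isOpen_lt continuous_const hcont).inter (isOpen_lt hcont continuous_const)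

theorem frontier_annulus_subset (p : EuclideanSpace ℝ (Fin n)) (δ R : ℝ) :
    frontier {y | δ < ‖y - p‖ ∧ ‖y - p‖ < R} ⊆ {y | ‖y - p‖ = δ ∨ ‖y - p‖ = R} := by
  intro y hy
  rw [(isOpen_annulus p δ R).frontier_eq] at hy
  have hcont : Continuous fun z : EuclideanSpace ℝ (Fin n) => ‖z - p‖ := by fun_prop
  have hcl : IsClosed {y | δ ≤ ‖y - p‖ ∧ ‖y - p‖ ≤ R} :=
    (isClosed_le continuous_const hcont).inter (isClosed_le hcont continuous_const)
  have h1 : δ ≤ ‖y - p‖ ∧ ‖y - p‖ ≤ R :=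
    closure_minimal (t := {y | δ ≤ ‖y - p‖ ∧ ‖y - p‖ ≤ R}) (fun z hz => ⟨hz.1.le, hz.2.le⟩)
      hcl hy.1
  by_contra h
  have h' := not_or.1 h
  exact hy.2 ⟨lt_of_le_of_ne h1.1 (Ne.symm h'.1), lt_of_le_of_ne h1.2 h'.2⟩

theorem isSmoothBoundedDomain_annulus (hn : 1 < n) (p : EuclideanSpace ℝ (Fin n)) {δ R : ℝ}
    (hδ : 0 < δ) (hR : δ < R) : IsSmoothBoundedDomain {y | δ < ‖y - p‖ ∧ ‖y - p‖ < R} where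
  isOpen := isOpen_annulus p δ R
  isConnected := isConnected_annulus hn p hδ hR
  isBounded := (Metric.isBounded_ball (x := p) (r := R)).subset fun y hy => by
    rw [Metric.mem_ball, dist_eq_norm]; exact hy.2
  smooth_boundary := fun y hy => by
    have hcont : Continuous fun z : EuclideanSpace ℝ (Fin n) => ‖z - p‖ := by fun_prop
    rcases frontier_annulus_subset p δ R hy with h | h
    · refine ⟨_, isDefiningFunctionAt_inner hδ h ?_⟩
      filter_upwards [hcont.continuousAt.eventually_lt_const (show ‖y - p‖ < R by rwa [h])]
        with z hz
      exact ⟨fun h => h.1, fun h => ⟨h, hz⟩⟩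
    · refine ⟨_, isDefiningFunctionAt_outer (hδ.trans hR) h ?_⟩
      filter_upwards [hcont.continuousAt.eventually_const_lt (show δ < ‖y - p‖ by rwa [h])]
        with z hz
      exact ⟨fun h => h.2, fun h => ⟨hz, h⟩⟩

end Domains

/-! ### The formula for `f = 1` forces a radial quadratic form -/

section Necessity

variable {A : Type*} [NormedRing A] [NormedAlgebra ℝ A] {n q : ℕ} {a b : Matrix (Fin n) (Fin q) A}

theorem isCauchyFunction_one (a : Matrix (Fin n) (Fin q) A)
    (D : Set (EuclideanSpace ℝ (Fin n))) : IsCauchyFunction a D fun _ => 1 :=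
  ⟨contDiffOn_const, fun x _ m => by simp⟩

theorem eq_zero_of_integral_closedBall_eq_zero {E : Type*} [NormedAddCommGroup E]
    [NormedSpace ℝ E] [FiniteDimensional ℝ E] [MeasurableSpace E] [BorelSpace E] {μ : Measure E}
    [μ.IsAddHaarMeasure] [CompleteSpace A] {g : E → A} (hg : Continuous g) {p : E} {r : ℝ}
    (hr : 0 < r) (h : ∀ δ, 0 < δ → δ < r → ∫ y in Metric.closedBall p δ, g y ∂μ = 0) :
    g p = 0 := by
  have : ProperSpace E := FiniteDimensional.proper ℝ E
  rw [← norm_le_zero_iff]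
  refine le_of_forall_pos_le_add fun η hη => ?_
  obtain ⟨s, hs, hball⟩ := Metric.mem_nhds_iff.1 (Metric.tendsto_nhds.1 (hg.tendsto p) η hη)
  set δ := min (s / 2) (r / 2) with hδ
  have hδ0 : 0 < δ := by positivity
  have hδs : δ < s := (min_le_left _ _).trans_lt (by linarith)
  have hδr : δ < r := (min_le_right _ _).trans_lt (by linarith)
  have hfin : μ (Metric.closedBall p δ) < ⊤ := measure_closedBall_lt_top
  have hpos : 0 < μ.real (Metric.closedBall p δ) :=
    ENNReal.toReal_pos (Metric.measure_closedBall_pos μ p hδ0).ne' hfin.ne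
  have hgi : IntegrableOn g (Metric.closedBall p δ) μ :=
    hg.continuousOn.integrableOn_compact (isCompact_closedBall p δ)
  have h1 : ‖∫ y in Metric.closedBall p δ, (g p - g y) ∂μ‖ ≤
      η * μ.real (Metric.closedBall p δ) := by
    refine norm_setIntegral_le_of_norm_le_const hfin fun y hy => ?_
    rw [← dist_eq_norm, dist_comm]
    exact (hball (Metric.closedBall_subset_ball hδs hy)).le
  have hci : IntegrableOn (fun _ => g p) (Metric.closedBall p δ) μ :=
    continuousOn_const.integrableOn_compact (isCompact_closedBall p δ)
  rw [integral_sub hci hgi, h δ hδ0 hδr, sub_zero, setIntegral_const,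
    norm_smul, Real.norm_of_nonneg hpos.le, mul_comm] at h1
  rw [zero_add]
  exact le_of_mul_le_mul_right h1 hpos

variable [CompleteSpace A]

/-- The ball of radius `2‖p‖` about `p` and the same ball with a small ball about `p` removed both
contain the origin, so both have flux `1`. The divergence thus integrates to zero over every small
ball about `p`. With `ε = ‖p‖/4` the cut-off does not reach these boundaries, which stay at distance
`‖p‖/2` from the origin. -/
theorem kernelDivergence_eq_zero (hn : 1 < n)
    (hb : ∀ D : Set (EuclideanSpace ℝ (Fin n)), IsSmoothBoundedDomain D → (0 : _) ∈ D →
      ∫ y in frontier D, kernelDensity a b D 0 y ∂μHE[n - 1] = 1)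
    {p : EuclideanSpace ℝ (Fin n)} (hp : p ≠ 0) {ε : ℝ} (hε : 0 < ε) (hεp : ε = ‖p‖ / 4) :
    kernelDivergence a b (ε⁻¹ • p) = 0 := by
  have hp0 : 0 < ‖p‖ := norm_pos_iff.2 hp
  set g : EuclideanSpace ℝ (Fin n) → A :=
    fun y => (ε ^ n)⁻¹ • kernelDivergence a b (ε⁻¹ • y) with hg
  have hgc : Continuous g := by
    have h1 : Continuous fun y : EuclideanSpace ℝ (Fin n) => ε⁻¹ • y := by fun_prop
    exact ((continuous_kernelDivergence a b).comp h1).const_smul _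
  have hflux : ∀ D : Set (EuclideanSpace ℝ (Fin n)), IsSmoothBoundedDomain D → (0 : _) ∈ D →
      (∀ y ∈ frontier D, ‖p‖ / 2 ≤ ‖y‖) → ∫ y in D, g y = 1 := by
    intro D hD h0 hfr
    have h1 := ((isCauchyFunction_one a D).boundary_integral_eq b hD (d := n - 1) (x := 0)
      (by omega) hε fun y hy => by
        rw [sub_zero, hεp]
        nlinarith [hfr y hy]).2
    simp only [one_mul, sub_zero] at h1
    rw [hb D hD h0] at h1
    exact h1.symm
  suffices h : g p = 0 by
    have hne : (ε ^ n)⁻¹ ≠ 0 := by positivity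
    exact (smul_eq_zero.1 h).resolve_left hne
  refine eq_zero_of_integral_closedBall_eq_zero (μ := volume) hgc (half_pos hp0)
    fun δ hδ0 hδ => ?_
  have hR : δ < 2 * ‖p‖ := by linarith
  set D := {y : EuclideanSpace ℝ (Fin n) | δ < ‖y - p‖ ∧ ‖y - p‖ < 2 * ‖p‖} with hDdef
  have hball := hflux (Metric.ball p (2 * ‖p‖)) (isSmoothBoundedDomain_ball p (by positivity))
    (by simp [hp0]) fun y hy => by
      rw [frontier_ball p (by positivity), mem_sphere_iff_norm] at hy
      linarith [norm_sub_le y p]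
  have hann := hflux D (isSmoothBoundedDomain_annulus hn p hδ0 hR)
    ⟨by rw [zero_sub, norm_neg]; linarith, by rw [zero_sub, norm_neg]; linarith⟩ fun y hy => by
      rcases frontier_annulus_subset p δ _ hy with h | h
      · have h1 := norm_sub_norm_le p y
        rw [norm_sub_rev, h] at h1
        linarith
      · linarith [norm_sub_le y p]
  have hunion : Metric.ball p (2 * ‖p‖) = D ∪ Metric.closedBall p δ := by
    ext y
    simp only [Metric.mem_ball, Metric.mem_closedBall, dist_eq_norm, mem_union, hDdef]
    constructor
    · intro h
      rcases lt_or_ge δ ‖y - p‖ with h1 | h1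
      · exact Or.inl ⟨h1, h⟩
      · exact Or.inr h1
    · rintro (h | h)
      · exact h.2
      · linarith
  have hdisj : Disjoint D (Metric.closedBall p δ) := by
    rw [Set.disjoint_left]
    intro y hy hy2
    rw [Metric.mem_closedBall, dist_eq_norm] at hy2
    exact absurd hy.1 (not_lt.2 hy2)
  have hi : ∀ s : Set (EuclideanSpace ℝ (Fin n)), s ⊆ Metric.closedBall p (2 * ‖p‖) →
      IntegrableOn g s := fun s hs =>
    (hgc.continuousOn.integrableOn_compact (isCompact_closedBall p _)).mono_set hs
  rw [hunion, setIntegral_union hdisj Metric.isClosed_closedBall.measurableSet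
    (hi _ fun y hy => by rw [Metric.mem_closedBall, dist_eq_norm]; exact hy.2.le)
    (hi _ (Metric.closedBall_subset_closedBall hR.le)), hann] at hball
  simpa using hball

theorem kernelForm_eq_of_flux (hn : 1 < n)
    (hb : ∀ D : Set (EuclideanSpace ℝ (Fin n)), IsSmoothBoundedDomain D → (0 : _) ∈ D →
      ∫ y in frontier D, kernelDensity a b D 0 y ∂μHE[n - 1] = 1)
    (p : EuclideanSpace ℝ (Fin n)) :
    kernelForm a b p = ‖p‖ ^ 2 • ((n : ℝ)⁻¹ • kernelTrace a b) := by
  rcases eq_or_ne p 0 with rfl | hp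
  · simp [kernelForm]
  have hn0 : (n : ℝ) ≠ 0 := by positivity
  have hp0 : 0 < ‖p‖ := norm_pos_iff.2 hp
  have h1 := kernelDivergence_eq_zero hn hb hp (ε := ‖p‖ / 4) (by positivity) rfl
  -- After rescaling, `‖u‖² = 16` lies beyond the cut-off, where `radialDivergence` vanishes. This
  -- expresses the derivative of the profile through its value, and the vanishing of
  -- `kernelDivergence` becomes a relation between form and trace.
  set u := (‖p‖ / 4)⁻¹ • p with hu
  have hun : ‖u‖ ^ 2 = 16 := by
    rw [hu, norm_smul, norm_inv, Real.norm_of_nonneg (by positivity)]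
    field_simp
    norm_num
  have h2 := radialDivergence_of_ge (n := n) (show (2 : ℝ) < 16 by norm_num)
  have hG : cutoffProfile n 16 ≠ 0 := by
    rw [cutoffProfile_of_ge (by norm_num)]
    exact (Real.rpow_pos_of_pos (by norm_num) _).ne'
  have h3 : 2 * deriv (cutoffProfile n) 16 = -(n * cutoffProfile n 16 / 16) := by
    rw [radialDivergence] at h2
    linarith
  rw [kernelDivergence, hun, h3, hu, kernelForm_smul] at h1
  have h4 : kernelForm a b p = (‖p‖ ^ 2 * (n : ℝ)⁻¹ * (cutoffProfile n 16)⁻¹) •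
      ((n * cutoffProfile n 16 / 16) • ((‖p‖ / 4)⁻¹ ^ 2 • kernelForm a b p)) := by
    rw [smul_smul, smul_smul]
    nth_rewrite 1 [← one_smul ℝ (kernelForm a b p)]
    congr 1
    field_simp
    norm_num
  have h5 : (n * cutoffProfile n 16 / 16) • ((‖p‖ / 4)⁻¹ ^ 2 • kernelForm a b p) =
      cutoffProfile n 16 • kernelTrace a b := by
    rw [neg_smul, ← sub_eq_add_neg, sub_eq_zero] at h1
    exact h1.symm
  rw [h4, h5, smul_smul, smul_smul]
  congr 1
  field_simp

/-- The Cauchy formula with linear `φₘ` exists if and only if the quadratic form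
`∑ₘ (∑ⱼ yⱼ a j m) φₘ(y)` equals `‖y‖²` for some choice of the coefficients of `φₘ`. -/
theorem admitsLinearCauchyFormula_iff (hn : 1 < n) (a : Matrix (Fin n) (Fin q) A) :
    AdmitsLinearCauchyFormula a ↔
      ∃ b : Matrix (Fin n) (Fin q) A, ∀ y, kernelForm a b y = ‖y‖ ^ 2 • (1 : A) := by
  have hm : 0 < radialMass n := radialMass_pos (by omega)
  have hsmul : ∀ (b : Matrix (Fin n) (Fin q) A) (t : ℝ) (y), kernelForm a (t • b) y =
      t • kernelForm a b y := by
    intro b t y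
    simp only [kernelForm, kernelNumerator, Finset.smul_sum]
    simp only [Matrix.smul_apply, sum_apply,
      ContinuousLinearMap.smulRight_apply, mul_smul_comm, Finset.smul_sum, smul_smul]
    refine Finset.sum_congr rfl fun j _ => Finset.sum_congr rfl fun m _ =>
      Finset.sum_congr rfl fun i _ => ?_
    congr 1
    ring
  constructor
  · rintro ⟨b, hb⟩
    have hflux : ∀ D : Set (EuclideanSpace ℝ (Fin n)), IsSmoothBoundedDomain D → (0 : _) ∈ D →
        ∫ y in frontier D, kernelDensity a b D 0 y ∂μHE[n - 1] = 1 := by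
      intro D hD h0
      simpa using (hb D hD _ (isCauchyFunction_one a D) 0 h0).2.symm
    have hform := kernelForm_eq_of_flux hn hflux
    have hball := isSmoothBoundedDomain_ball (0 : EuclideanSpace ℝ (Fin n)) one_pos
    have h1 := ((isCauchyFunction_one a _).boundary_integral_eq_of_kernelForm hball
      (d := n - 1) (by omega) hform (Metric.mem_ball_self one_pos)).2
    simp only [one_mul] at h1
    rw [hflux _ hball (Metric.mem_ball_self one_pos)] at h1
    -- Comparing the two values of the flux through the unit ball gives `radialMass n • c = 1`, with
    -- `c` the trace divided by `n`; this fixes the scaling.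
    refine ⟨radialMass n • b, fun y => ?_⟩
    rw [hsmul, hform, smul_comm, ← h1]
  · rintro ⟨b, hb⟩
    refine ⟨(radialMass n)⁻¹ • b, fun D hD f hf x hx => ?_⟩
    have h := hf.boundary_integral_eq_of_kernelForm (b := (radialMass n)⁻¹ • b)
      (c := (radialMass n)⁻¹ • 1) hD (d := n - 1) (by omega)
      (fun y => by rw [hsmul, hb, smul_comm]) hx
    refine ⟨h.1, ?_⟩
    rw [h.2, mul_smul_comm, mul_one, smul_smul, mul_inv_cancel₀ hm.ne', one_smul]

end Necessity

end CauchyAlgebra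

namespace CauchyAlgebra

/-! ### Coefficients of the quadratic form -/

section QuadraticForm

variable {A : Type*} [NormedRing A] [NormedAlgebra ℝ A] {n q : ℕ}

/-- The coefficients `∑ₘ a j m b i m` of `kernelForm a b`. -/
def kernelGram (a b : Matrix (Fin n) (Fin q) A) (j i : Fin n) : A := ∑ m, a j m * b i m

theorem kernelForm_eq_sum (a b : Matrix (Fin n) (Fin q) A) (y : EuclideanSpace ℝ (Fin n)) :
    kernelForm a b y = ∑ j, ∑ i, (y j * y i) • kernelGram a b j i := by
  simp only [kernelForm, kernelNumerator, kernelGram, sum_apply,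
    ContinuousLinearMap.smulRight_apply, PiLp.proj_apply, Finset.smul_sum, smul_smul]
  exact Finset.sum_congr rfl fun j _ => Finset.sum_comm

/-- Polarization: only the symmetrized coefficients are visible, and they are read off at `e_i` and
`e_i + e_j`. For the converse the form is doubled so as to symmetrize, then `2` is cancelled. -/
theorem kernelForm_eq_norm_sq_iff (a b : Matrix (Fin n) (Fin q) A) :
    (∀ y, kernelForm a b y = ‖y‖ ^ 2 • (1 : A)) ↔
      (∀ i, kernelGram a b i i = 1) ∧
        ∀ i j, i < j → kernelGram a b i j + kernelGram a b j i = 0 := by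
  constructor
  · intro h
    have hdiag : ∀ i, kernelGram a b i i = 1 := by
      intro i
      have h1 := h (EuclideanSpace.single i 1)
      rw [kernelForm_eq_sum, Finset.sum_eq_single i (fun j _ hj => by simp [hj]) (by simp),
        Finset.sum_eq_single i (fun j _ hj => by simp [hj]) (by simp)] at h1
      simpa using h1
    refine ⟨hdiag, fun i j hij => ?_⟩
    have hij' : i ≠ j := hij.ne
    have h1 := h (EuclideanSpace.single i 1 + EuclideanSpace.single j 1)
    rw [EuclideanSpace.norm_sq_eq, kernelForm_eq_sum] at h1
    have h2 : ∀ k, (EuclideanSpace.single i (1 : ℝ) + EuclideanSpace.single j 1 :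
        EuclideanSpace ℝ (Fin n)) k = (if k = i then 1 else 0) + if k = j then 1 else 0 := by
      intro k
      simp
    simp only [h2, mul_add, add_smul, Finset.sum_add_distrib, mul_ite, mul_one, mul_zero,
      ite_smul, one_smul, zero_smul, Finset.sum_ite_eq', Finset.mem_univ, if_true, hdiag] at h1
    have h3 : ∑ k, ‖(if k = i then (1 : ℝ) else 0) + if k = j then 1 else 0‖ ^ 2 = 2 := by
      have : ∀ k, ‖(if k = i then (1 : ℝ) else 0) + if k = j then 1 else 0‖ ^ 2 =
          (if k = i then 1 else 0) + if k = j then 1 else 0 := by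
        intro k
        by_cases hi : k = i
        · simp [hi, hij']
        · by_cases hj : k = j
          · simp [hj, hij'.symm]
          · simp [hi, hj]
      simp only [this, Finset.sum_add_distrib, Finset.sum_ite_eq', Finset.mem_univ, if_true]
      norm_num
    rw [h3, two_smul] at h1
    have h4 : kernelGram a b i j + kernelGram a b j i =
        (1 + kernelGram a b j i + (kernelGram a b i j + 1)) - (1 + 1) := by abel
    rw [h4, sub_eq_zero]
    convert h1 using 1
  · rintro ⟨h1, h2⟩ y
    have hsymm : ∀ i j, kernelGram a b i j + kernelGram a b j i = if i = j then 2 else 0 := by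
      intro i j
      rcases lt_trichotomy i j with h | h | h
      · rw [if_neg h.ne, h2 i j h]
      · rw [if_pos h, h, h1]; norm_num
      · rw [if_neg h.ne', add_comm, h2 j i h]
    have h3 : (2 : ℝ) • kernelForm a b y = (2 : ℝ) • (‖y‖ ^ 2 • (1 : A)) := by
      calc (2 : ℝ) • kernelForm a b y = kernelForm a b y + kernelForm a b y := two_smul _ _
        _ = ∑ j, ∑ i, (y j * y i) • (kernelGram a b j i + kernelGram a b i j) := by
          simp only [smul_add, Finset.sum_add_distrib]
          rw [kernelForm_eq_sum]
          congr 1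
          rw [Finset.sum_comm]
          simp only [mul_comm]
        _ = (2 : ℝ) • (‖y‖ ^ 2 • (1 : A)) := by
          simp only [hsymm, smul_ite, smul_zero, Finset.sum_ite_eq, Finset.mem_univ, if_true]
          rw [EuclideanSpace.norm_sq_eq, Finset.sum_smul, Finset.smul_sum]
          refine Finset.sum_congr rfl fun j _ => ?_
          rw [Real.norm_eq_abs, sq_abs, smul_comm, sq]
          congr 1
          rw [two_smul]; norm_num
    exact (smul_right_injective A (two_ne_zero (α := ℝ))) h3

end QuadraticForm

/-! ### Antisymmetric matrices and the right submodule of commutators -/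

section Elimination

variable {A : Type*} [Ring A] {q : ℕ}

/-- The terms for `(k, m)` and `(m, k)` are paired: antisymmetry of `S` turns each pair into a
difference of the two values of `X`, which is how the commutators arise. -/
theorem sum_mul_eq_of_antisymm {X S : Fin q → Fin q → A} (hdiag : ∀ k, S k k = 1)
    (hanti : ∀ k l, k < l → S k l + S l k = 0) :
    ∑ k, ∑ m, X k m * S m k =
      ∑ k, X k k + ∑ m, ∑ m', if m < m' then (X m' m - X m m') * S m m' else 0 := by
  have h1 : ∀ k m, X k m * S m k = (if k = m then X k m else 0) +
      ((if m < k then X k m * S m k else 0) + if k < m then -(X k m * S k m) else 0) := by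
    intro k m
    rcases lt_trichotomy k m with h | h | h
    · rw [if_neg h.ne, if_neg h.not_gt, if_pos h, eq_neg_of_add_eq_zero_right (hanti k m h)]
      simp
    · subst h
      simp [hdiag]
    · simp [h, h.ne', h.not_gt]
  have h2 : ∀ m m', (if m < m' then (X m' m - X m m') * S m m' else 0) =
      (if m < m' then X m' m * S m m' else 0) + if m < m' then -(X m m' * S m m') else 0 := by
    intro m m'
    split_ifs
    · rw [sub_mul, sub_eq_add_neg]
    · simp
  rw [Finset.sum_congr rfl fun k _ => Finset.sum_congr rfl fun m _ => h1 k m]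
  simp only [h2, Finset.sum_add_distrib, Finset.sum_ite_eq, Finset.mem_univ, if_true]
  congr 2
  exact Finset.sum_comm

theorem mem_span_op_iff {M : Type*} [AddCommGroup M] [Module Aᵐᵒᵖ M] (T : Fin q → Fin q → M)
    (x : M) : x ∈ Submodule.span Aᵐᵒᵖ {t : M | ∃ m m' : Fin q, m < m' ∧ t = T m m'} ↔
      ∃ s : Fin q → Fin q → A,
        x = ∑ m, ∑ m', if m < m' then MulOpposite.op (s m m') • T m m' else 0 := by
  constructor
  · intro hx
    induction hx using Submodule.span_induction with
    | mem t ht =>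
      obtain ⟨m, m', hmm, rfl⟩ := ht
      refine ⟨fun k l => if k = m ∧ l = m' then 1 else 0, ?_⟩
      rw [Finset.sum_eq_single m, Finset.sum_eq_single m']
      · simp [hmm]
      · intro l _ hl; simp [hl]
      · simp
      · intro k _ hk; simp [hk]
      · simp
    | zero => exact ⟨fun _ _ => 0, by simp⟩
    | add x y _ _ hx hy =>
      obtain ⟨s, rfl⟩ := hx
      obtain ⟨t, rfl⟩ := hy
      refine ⟨fun k l => s k l + t k l, ?_⟩
      simp only [← Finset.sum_add_distrib]
      refine Finset.sum_congr rfl fun m _ => Finset.sum_congr rfl fun m' _ => ?_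
      split_ifs
      · rw [MulOpposite.op_add, add_smul]
      · simp
    | smul r x _ hx =>
      obtain ⟨s, rfl⟩ := hx
      refine ⟨fun k l => s k l * r.unop, ?_⟩
      simp only [Finset.smul_sum]
      refine Finset.sum_congr rfl fun m _ => Finset.sum_congr rfl fun m' _ => ?_
      split_ifs
      · rw [MulOpposite.op_mul, MulOpposite.op_unop, mul_smul]
      · simp
  · rintro ⟨s, rfl⟩
    refine Submodule.sum_mem _ fun m _ => Submodule.sum_mem _ fun m' _ => ?_
    split_ifs with h
    · exact Submodule.smul_mem _ _ (Submodule.subset_span ⟨m, m', h, rfl⟩)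
    · exact Submodule.zero_mem _

/-- Inserting `c m' * γ m' = 1` shows each entry to be a commutator-type expression times `γ m'` on
the right; as this factor is a unit, a right coefficient can absorb it. -/
theorem commutatorTriple_eq {α β γ c : Fin q → A} (hc : ∀ k, c k * γ k = 1) (m m' : Fin q) :
    commutatorTriple α β γ c m m' =
      (((α m' * c m') * (α m * c m) - (α m * c m) * (α m' * c m')) * γ m',
        ((β m' * c m') * (β m * c m) - (β m * c m) * (β m' * c m')) * γ m',
        (((α m' * c m') * (β m * c m) + (β m' * c m') * (α m * c m)) -
          ((α m * c m) * (β m' * c m') + (β m * c m) * (α m' * c m'))) * γ m') := by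
  have h : ∀ x z : A, x * (z * c m') * γ m' = x * z := fun x z => by
    rw [mul_assoc, mul_assoc, hc, mul_one]
  simp only [commutatorTriple, sub_mul, add_mul, h]
  refine Prod.ext rfl (Prod.ext rfl ?_)
  dsimp only
  abel

/-- Membership of `conditionTriple` in the submodule, in terms of a matrix `S` which is
antisymmetric off the diagonal. -/
theorem conditionTriple_mem_iff {α β γ c : Fin q → A} (hc : ∀ k, c k * γ k = 1)
    (hc' : ∀ k, γ k * c k = 1) :
    conditionTriple α β c ∈ Submodule.span Aᵐᵒᵖ
        {t : A × A × A | ∃ m m' : Fin q, m < m' ∧ t = commutatorTriple α β γ c m m'} ↔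
      ∃ S : Fin q → Fin q → A, (∀ k, S k k = 1) ∧ (∀ k l, k < l → S k l + S l k = 0) ∧
        1 + ∑ k, ∑ m, (α k * c k) * (α m * c m) * S m k = 0 ∧
        1 + ∑ k, ∑ m, (β k * c k) * (β m * c m) * S m k = 0 ∧
        ∑ k, ∑ m, ((α k * c k) * (β m * c m) + (β k * c k) * (α m * c m)) * S m k = 0 := by
  rw [mem_span_op_iff]
  have hterm : ∀ (s : Fin q → Fin q → A) (m m' : Fin q),
      (if m < m' then MulOpposite.op (s m m') • commutatorTriple α β γ c m m' else 0) =
      ((if m < m' then ((α m' * c m') * (α m * c m) - (α m * c m) * (α m' * c m')) *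
          (γ m' * s m m') else 0),
        (if m < m' then ((β m' * c m') * (β m * c m) - (β m * c m) * (β m' * c m')) *
          (γ m' * s m m') else 0),
        if m < m' then (((α m' * c m') * (β m * c m) + (β m' * c m') * (α m * c m)) -
          ((α m * c m) * (β m' * c m') + (β m * c m) * (α m' * c m'))) *
            (γ m' * s m m') else 0) := by
    intro s m m'
    split_ifs
    · simp only [commutatorTriple_eq hc, Prod.smul_mk, MulOpposite.smul_eq_mul_unop,
        MulOpposite.unop_op, mul_assoc]
    · rfl
  have hneg : ∀ (S s : Fin q → Fin q → A) (X : Fin q → Fin q → A),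
      (∀ m m', m < m' → γ m' * s m m' = -S m m') →
      ∑ m, ∑ m', (if m < m' then (X m' m - X m m') * (γ m' * s m m') else 0) =
        -∑ m, ∑ m', if m < m' then (X m' m - X m m') * S m m' else 0 := by
    intro S s X h
    simp only [← Finset.sum_neg_distrib]
    refine Finset.sum_congr rfl fun m _ => Finset.sum_congr rfl fun m' _ => ?_
    split_ifs with hm
    · rw [h m m' hm, mul_neg]
    · simp
  have hmain : ∀ S s : Fin q → Fin q → A, (∀ k, S k k = 1) →
      (∀ k l, k < l → S k l + S l k = 0) → (∀ m m', m < m' → γ m' * s m m' = -S m m') →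
      ((conditionTriple α β c =
        ∑ m, ∑ m', if m < m' then MulOpposite.op (s m m') • commutatorTriple α β γ c m m' else 0) ↔
        1 + ∑ k, ∑ m, (α k * c k) * (α m * c m) * S m k = 0 ∧
        1 + ∑ k, ∑ m, (β k * c k) * (β m * c m) * S m k = 0 ∧
        ∑ k, ∑ m, ((α k * c k) * (β m * c m) + (β k * c k) * (α m * c m)) * S m k = 0) := by
    intro S s h1 h2 h3
    simp only [hterm]
    rw [sum_mul_eq_of_antisymm (X := fun k m => (α k * c k) * (α m * c m)) h1 h2,
      sum_mul_eq_of_antisymm (X := fun k m => (β k * c k) * (β m * c m)) h1 h2,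
      sum_mul_eq_of_antisymm
        (X := fun k m => (α k * c k) * (β m * c m) + (β k * c k) * (α m * c m)) h1 h2]
    have e1 := hneg S s (fun k m => (α k * c k) * (α m * c m)) h3
    have e2 := hneg S s (fun k m => (β k * c k) * (β m * c m)) h3
    have e3 := hneg S s (fun k m => (α k * c k) * (β m * c m) + (β k * c k) * (α m * c m)) h3
    rw [conditionTriple, Prod.ext_iff, Prod.ext_iff]
    simp only [Prod.fst_sum, Prod.snd_sum, e1, e2, e3, sq, eq_neg_iff_add_eq_zero, add_assoc]
  constructor
  · rintro ⟨s, hs⟩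
    -- The submodule coefficients determine `S` above the diagonal by `S k l = -(γ l * s k l)`; unit
    -- diagonal and antisymmetry then prescribe the rest.
    refine ⟨fun k l => if k = l then 1 else if k < l then -(γ l * s k l) else γ k * s l k,
      fun k => by simp, fun k l hkl => ?_, (hmain _ s ?_ ?_ ?_).1 hs⟩
    · simp [hkl, hkl.ne, hkl.ne', hkl.not_gt]
    · simp
    · intro k l hkl
      simp [hkl, hkl.ne, hkl.ne', hkl.not_gt]
    · intro k l hkl
      simp [hkl, hkl.ne]
  · rintro ⟨S, h1, h2, h3⟩
    refine ⟨fun k l => -(c l * S k l), (hmain S _ h1 h2 fun m m' _ => ?_).2 h3⟩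
    rw [mul_neg, ← mul_assoc, hc', one_mul]

end Elimination

/-! ### From the quadratic form to the algebraic condition -/

section Reduction

variable {A : Type*} [NormedRing A] [NormedAlgebra ℝ A] {q : ℕ} {α β γ : Fin q → A}

/-- Left multiplication by `y` is injective because `x` undoes it, hence surjective by finite
dimension, so `y` also has a right inverse, which must be `x`. -/
theorem isUnit_of_mul_eq_one_of_finiteDimensional [FiniteDimensional ℝ A] {x y : A}
    (h : x * y = 1) : IsUnit x := by
  have : IsNoetherian ℝ A := inferInstance
  have hinj : Function.Injective (LinearMap.mulLeft ℝ y) := by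
    intro u v huv
    have h1 : x * (y * u) = x * (y * v) := congrArg (x * ·) huv
    rwa [← mul_assoc, ← mul_assoc, h, one_mul, one_mul] at h1
  obtain ⟨z, hz⟩ := LinearMap.surjective_of_injective hinj 1
  have hz' : y * z = 1 := hz
  have hxz : x = z := by rw [← mul_one x, ← hz', ← mul_assoc, h, one_mul]
  exact ⟨⟨x, y, h, by rw [hxz, hz']⟩, rfl⟩

theorem kernelForm_coeffMatrix_iff (b : Matrix (Fin (q + 2)) (Fin q) A) :
    (∀ y, kernelForm (coeffMatrix α β γ) b y = ‖y‖ ^ 2 • (1 : A)) ↔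
      (∑ m, α m * b 0 m = 1) ∧ (∑ m, β m * b 1 m = 1) ∧ (∀ k, γ k * b k.succ.succ k = 1) ∧
      (∑ m, α m * b 1 m + ∑ m, β m * b 0 m = 0) ∧
      (∀ k, ∑ m, α m * b k.succ.succ m + γ k * b 0 k = 0) ∧
      (∀ k, ∑ m, β m * b k.succ.succ m + γ k * b 1 k = 0) ∧
      ∀ k l, k < l → γ k * b l.succ.succ k + γ l * b k.succ.succ l = 0 := by
  have h0 : ∀ i, kernelGram (coeffMatrix α β γ) b 0 i = ∑ m, α m * b i m := fun i => rfl
  have h1 : ∀ i, kernelGram (coeffMatrix α β γ) b 1 i = ∑ m, β m * b i m := fun i => rfl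
  have h2 : ∀ k i, kernelGram (coeffMatrix α β γ) b (Fin.succ (Fin.succ k)) i = γ k * b i k := by
    intro k i
    have : ∀ m, coeffMatrix α β γ k.succ.succ m = Matrix.diagonal γ k m := fun m => rfl
    rw [kernelGram, Finset.sum_eq_single k]
    · rw [this, Matrix.diagonal_apply_eq]
    · intro m _ hm
      rw [this, Matrix.diagonal_apply_ne _ hm.symm, zero_mul]
    · simp
  rw [kernelForm_eq_norm_sq_iff]
  have hone : (Fin.succ 0 : Fin (q + 2)) = 1 := rfl
  simp only [Fin.forall_fin_succ, hone, h0, h1, h2]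
  simp only [Fin.succ_lt_succ_iff, lt_self_iff_false, Fin.not_lt_zero, false_imp_iff,
    Fin.succ_pos, forall_const, true_and]
  have h01 : (0 : Fin (q + 2)) < 1 := Fin.succ_pos 0
  have h1k : ∀ k : Fin q, (1 : Fin (q + 2)) < k.succ.succ := fun k =>
    Fin.succ_lt_succ_iff.2 (Fin.succ_pos k)
  have hk1 : ∀ k : Fin q, ¬ k.succ.succ < (1 : Fin (q + 2)) := fun k => (h1k k).not_gt
  simp only [h01, h1k, hk1, false_imp_iff, forall_const, true_and, and_assoc]

theorem exists_kernelForm_iff_algebraicCondition [FiniteDimensional ℝ A] :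
    (∃ b, ∀ y, kernelForm (coeffMatrix α β γ) b y = ‖y‖ ^ 2 • (1 : A)) ↔
      AlgebraicCondition α β γ := by
  simp only [kernelForm_coeffMatrix_iff]
  constructor
  · rintro ⟨b, hα, hβ, hγ, hαβ, hαk, hβk, hkl⟩
    have hunit : ∀ k, IsUnit (γ k) := fun k => isUnit_of_mul_eq_one_of_finiteDimensional (hγ k)
    set c : Fin q → A := fun k => Ring.inverse (γ k) with hc
    have hcγ : ∀ k, c k * γ k = 1 := fun k => Ring.inverse_mul_cancel _ (hunit k)
    have hγc : ∀ k, γ k * c k = 1 := fun k => Ring.mul_inverse_cancel _ (hunit k)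
    refine ⟨hunit, (conditionTriple_mem_iff hcγ hγc).2
      -- The equations among the last `q` coordinates say exactly that this matrix has unit diagonal
      -- and is antisymmetric off it.
      ⟨fun k l => γ k * b l.succ.succ k, hγ, hkl, ?_⟩⟩
    have hcancel : ∀ (x : A) (m : Fin q) (z : A), x * c m * (γ m * z) = x * z := fun x m z => by
      rw [mul_assoc, ← mul_assoc (c m), hcγ, one_mul]
    -- The mixed equations give `γ k * p k` in terms of the lower rows of `b`. Multiplying by `ζ k *
    -- c k` and summing removes row `p`, that is `b 0` or `b 1`, from the three remaining equations.
    have hred : ∀ (ξ : Fin q → A) (p : Fin q → A),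
        (∀ k, ∑ m, ξ m * b k.succ.succ m + γ k * p k = 0) → ∀ ζ : Fin q → A,
        ∑ k, ∑ m, (ζ k * c k) * (ξ m * c m) * (γ m * b k.succ.succ m) = -∑ k, ζ k * p k := by
      intro ξ p h ζ
      rw [← Finset.sum_neg_distrib]
      refine Finset.sum_congr rfl fun k _ => ?_
      have h1 : ∀ m, (ζ k * c k) * (ξ m * c m) * (γ m * b k.succ.succ m) =
          ζ k * c k * (ξ m * b k.succ.succ m) := fun m => by
        rw [mul_assoc (ζ k * c k), hcancel]
      simp only [h1, ← Finset.mul_sum]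
      rw [eq_neg_of_add_eq_zero_left (h k), mul_neg, hcancel]
    refine ⟨?_, ?_, ?_⟩
    · rw [hred α (b 0) hαk α, hα, add_neg_cancel]
    · rw [hred β (b 1) hβk β, hβ, add_neg_cancel]
    · simp only [add_mul, Finset.sum_add_distrib]
      rw [hred β (b 1) hβk α, hred α (b 0) hαk β, ← neg_add, hαβ, neg_zero]
  · rintro ⟨hunit, hmem⟩
    set c : Fin q → A := fun k => Ring.inverse (γ k) with hc
    have hcγ : ∀ k, c k * γ k = 1 := fun k => Ring.inverse_mul_cancel _ (hunit k)
    have hγc : ∀ k, γ k * c k = 1 := fun k => Ring.mul_inverse_cancel _ (hunit k)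
    obtain ⟨S, hS1, hS2, h1, h2, h3⟩ := (conditionTriple_mem_iff hcγ hγc).1 hmem
    -- The first two rows of `b` have no freedom left: they are the solutions of the mixed equations
    -- once `S` is given, and the lower rows are `S` divided by `γ` on the left.
    let P : (Fin q → A) → Fin q → A := fun ξ k => -(c k * ∑ m, ξ m * c m * S m k)
    have hγ' : ∀ k z, γ k * (c k * z) = z := fun k z => by rw [← mul_assoc, hγc, one_mul]
    have hP : ∀ ζ ξ : Fin q → A, ∑ k, ζ k * P ξ k =
        -∑ k, ∑ m, (ζ k * c k) * (ξ m * c m) * S m k := by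
      intro ζ ξ
      simp only [P, mul_neg, Finset.sum_neg_distrib, Finset.mul_sum, mul_assoc]
    refine ⟨Matrix.of (Matrix.vecCons (P α) (Matrix.vecCons (P β) fun l k => c k * S k l)),
      ?_, ?_, ?_, ?_, ?_, ?_, ?_⟩
    · change ∑ k, α k * P α k = 1
      rw [hP, ← add_eq_zero_iff_eq_neg'.1 (by rw [add_comm]; exact h1)]
    · change ∑ k, β k * P β k = 1
      rw [hP, ← add_eq_zero_iff_eq_neg'.1 (by rw [add_comm]; exact h2)]
    · intro k
      change γ k * (c k * S k k) = 1
      rw [hγ', hS1]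
    · change ∑ k, α k * P β k + ∑ k, β k * P α k = 0
      rw [hP, hP, ← neg_add, ← Finset.sum_add_distrib, neg_eq_zero, ← h3]
      simp only [add_mul, Finset.sum_add_distrib]
    · intro k
      change ∑ m, α m * (c m * S m k) + γ k * P α k = 0
      simp only [P, mul_neg, hγ', mul_assoc, add_neg_cancel]
    · intro k
      change ∑ m, β m * (c m * S m k) + γ k * P β k = 0
      simp only [P, mul_neg, hγ', mul_assoc, add_neg_cancel]
    · intro k l hkl
      change γ k * (c k * S k l) + γ l * (c l * S l k) = 0
      rw [hγ', hγ', hS2 k l hkl]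

end Reduction

end CauchyAlgebra

theorem mainTheorem9 {A : Type*} [NormedRing A] [NormedAlgebra ℝ A] [FiniteDimensional ℝ A]
    (q : ℕ) (hdim : Module.finrank ℝ A = q + 2) (α β γ : Fin q → A) :
    CauchyAlgebra.AdmitsLinearCauchyFormula (CauchyAlgebra.coeffMatrix α β γ) ↔
      CauchyAlgebra.AlgebraicCondition α β γ := by
  have : CompleteSpace A := FiniteDimensional.complete ℝ A
  rw [CauchyAlgebra.admitsLinearCauchyFormula_iff (by omega),
    CauchyAlgebra.exists_kernelForm_iff_algebraicCondition]
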